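/- Let $-A$ be the generator of a bounded $C_0$-semigroup $(e^{-tA})_{t\ge 0}$ on a complex Banach space $X$ such that $\overline{\operatorname{ran}}(A)=X$ and $\{|s| : s\in\mathbb R,\ is\in\sigma(A)\}=\mathbb R_+=[0,\infty)$. Let $\mathcal B_2$ denote the set of bounded completely monotone functions $g$ on $(0,\infty)$ with $g(0+)=1$, $g'(0+)=-1$ and $g''(0+)<\infty$. For $g\in\mathcal B_2$, with representing measure $\nu$ (so $g(z)=\int_{[0,\infty)} e^{-zs}\,\nu(ds)$ for $z>0$), put $g(rA)=\int_{[0,\infty)} e^{-srA}\,\nu(ds)$ for $r>0$ (a strong integral). Let $A^{-\alpha}$ be the fractional power of $A$, that is, the closed operator $f(A)$ given by the extended Hille–Phillips calculus for $f(z)=z^{-\alpha}$: $f(A)=e(A)^{-1}(ef)(A)$, where $e$ and $ef$ are Laplace transforms of bounded complex measures on $[0,\infty)$ and $e(A)$ is injective. Let $g\in\mathcal B_2$ with $g(z)\not\equiv e^{-z}$. Then there exists $c>0$ such that for all $\alpha\in(0,2]$, $t>0$ and $n\in\mathbb N=\{1,2,\dots\}$ the operator $A^{-\alpha}\bigl(g^n(tA/n)-e^{-tA}\bigr)$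 is everywhere defined and bounded on $X$, and $$\bigl\|A^{-\alpha}\bigl(g^n(tA/n)-e^{-tA}\bigr)\bigr\|\ \ge\ c\left(\frac{t^2}{n}\right)^{\alpha/2}.$$ -/

import Mathlib

open Set Filter Topology MeasureTheory
open scoped NNReal ContDiff

/-! ### Strongly continuous semigroups and their generators -/

/-- A `C₀`-semigroup of bounded linear operators on `X`. -/
structure C0Semigroup (X : Type*) [NormedAddCommGroup X] [NormedSpace ℂ X] where
  /-- the operator at time `t` -/
  op : ℝ≥0 → X →L[ℂ] X
  op_zero : op 0 = ContinuousLinearMap.id ℂ X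
  op_add : ∀ s t : ℝ≥0, op (s + t) = (op s).comp (op t)
  continuous_op : ∀ x : X, Continuous fun t : ℝ≥0 => op t x

namespace C0Semigroup

variable {X : Type*} [NormedAddCommGroup X] [NormedSpace ℂ X]

/-- The semigroup is bounded: `sup_{t ≥ 0} ‖T t‖ < ∞`. -/
def IsBounded (T : C0Semigroup X) : Prop :=
  ∃ M : ℝ, ∀ t : ℝ≥0, ‖T.op t‖ ≤ M

/-- The graph of the generator: the pairs `(x, y)` with `(T h x - x) / h → y` as `h → 0+`. -/
def generatorGraph (T : C0Semigroup X) : Submodule ℂ (X × X) where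
  carrier := {p | Tendsto (fun h : ℝ≥0 => ((h : ℝ)⁻¹ : ℂ) • (T.op h p.1 - p.1))
    (𝓝[>] 0) (𝓝 p.2)}
  zero_mem' := by simp
  add_mem' := by
    intro p q hp hq
    have h := Tendsto.add hp hq
    refine Tendsto.congr (fun t => ?_) h
    simp only [Prod.fst_add, map_add]
    rw [← smul_add]
    congr 1
    abel
  smul_mem' := by
    intro c p hp
    have h := Tendsto.const_smul hp c
    refine Tendsto.congr (fun t => ?_) h
    simp only [Prod.smul_fst, map_smul]
    rw [smul_comm, ← smul_sub]

/-- The (in general unbounded) generator of a `C₀`-semigroup, on its maximal domain. -/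
noncomputable def generator (T : C0Semigroup X) : X →ₗ.[ℂ] X :=
  T.generatorGraph.toLinearPMap

/-- The graph of the generator is what it should be. -/
theorem generator_graph (T : C0Semigroup X) : T.generator.graph = T.generatorGraph := by
  refine Submodule.toLinearPMap_graph_eq _ ?_
  rintro ⟨x, y⟩ hp hx
  have hx' : x = 0 := hx
  subst hx'
  have hp' : Tendsto (fun h : ℝ≥0 => ((h : ℝ)⁻¹ : ℂ) • (T.op h (0 : X) - 0))
    (𝓝[>] 0) (𝓝 y) := hp
  simp only [map_zero, sub_zero, smul_zero] at hp'
  exact tendsto_nhds_unique hp' tendsto_const_nhds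

/-- The rescaled semigroup `s ↦ T (r s)`. If `T s = e^{-sA}`, this is `s ↦ e^{-s(rA)}`. -/
def rescale (T : C0Semigroup X) (r : ℝ≥0) : C0Semigroup X where
  op := fun s => T.op (r * s)
  op_zero := by simp [T.op_zero]
  op_add := by
    intro s t
    rw [mul_add, T.op_add]
  continuous_op := fun x => (T.continuous_op x).comp (continuous_const.mul continuous_id)

end C0Semigroup

/-! ### The spectrum of an unbounded operator -/

/-- `z` is in the resolvent set of `A`: `z - A : dom A → X` has a bounded two-sided inverse. -/
def UnboundedOp.resolventSet {X : Type*} [NormedAddCommGroup X] [NormedSpace ℂ X]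
    (A : X →ₗ.[ℂ] X) : Set ℂ :=
  {z | ∃ R : X →L[ℂ] X,
    (∀ x : X, ∃ h : R x ∈ A.domain, z • R x - A ⟨R x, h⟩ = x) ∧
    (∀ x : A.domain, R (z • (x : X) - A x) = x)}

/-- The spectrum `σ(A)` of an unbounded operator. -/
def UnboundedOp.spectrum {X : Type*} [NormedAddCommGroup X] [NormedSpace ℂ X]
    (A : X →ₗ.[ℂ] X) : Set ℂ :=
  (UnboundedOp.resolventSet A)ᶜ

/-! ### Completely monotone functions

Functions on `(0, ∞)` are represented by functions on `ℝ` whose values outside `(0, ∞)`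
are irrelevant. -/

/-- `g` is completely monotone on `(0, ∞)`. -/
def IsCompletelyMonotone (g : ℝ → ℝ) : Prop :=
  ContDiffOn ℝ ∞ g (Ioi 0) ∧ ∀ (n : ℕ) (t : ℝ), 0 < t → 0 ≤ (-1 : ℝ) ^ n * iteratedDeriv n g t

/-- The class of bounded completely monotone functions. -/
def ClassBM : Set (ℝ → ℝ) :=
  {g | IsCompletelyMonotone g ∧ ∃ C : ℝ, ∀ t : ℝ, 0 < t → g t ≤ C}

/-- Bounded completely monotone functions with `g(0+) = 1` and `g'(0+) = -1`. -/
def ClassB1 : Set (ℝ → ℝ) :=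
  {g | g ∈ ClassBM ∧ Tendsto g (𝓝[>] 0) (𝓝 1) ∧ Tendsto (deriv g) (𝓝[>] 0) (𝓝 (-1))}

/-- The functions of the class `ClassB1` for which `g''(0+)` is finite. -/
def ClassB2 : Set (ℝ → ℝ) :=
  {g | g ∈ ClassB1 ∧ ∃ L : ℝ, Tendsto (iteratedDeriv 2 g) (𝓝[>] 0) (𝓝 L)}

/-- `g ∼ ν`: the function `g` is the Laplace transform of the measure `ν` on `[0, ∞)`. -/
def IsLaplaceTransformOf (g : ℝ → ℝ) (ν : Measure ℝ≥0) : Prop :=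
  ∀ t : ℝ, 0 < t → g t = ∫ s : ℝ≥0, Real.exp (-(t * (s : ℝ))) ∂ν

/-! ### The Hille-Phillips functional calculus and its extension -/

section HillePhillips

variable {X : Type*} [NormedAddCommGroup X] [NormedSpace ℂ X]

open Classical in
/-- For a bounded completely monotone `g ∼ ν` and the semigroup `T t = e^{-tA}`, the operator
`g(A) = ∫ e^{-sA} ν(ds)` (strong integral). The representing measure is unique. -/
noncomputable def cmOp (T : C0Semigroup X) (g : ℝ → ℝ) : X →L[ℂ] X :=
  if h : ∃ S : X →L[ℂ] X, ∃ ν : Measure ℝ≥0, IsFiniteMeasure ν ∧ IsLaplaceTransformOf g ν ∧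
      ∀ x : X, S x = ∫ s : ℝ≥0, T.op s x ∂ν
  then h.choose else 0

/-- The function `f`, considered on the open right half-plane, is the Laplace transform of the
bounded complex Borel measure `w μ` on `[0, ∞)`. By polar decomposition every bounded complex
measure is of the form `w μ` with a finite positive measure `μ` and a `μ`-integrable density `w`. -/
def IsLaplaceTransformOn (f : ℂ → ℂ) (μ : Measure ℝ≥0) (w : ℝ≥0 → ℂ) : Prop :=
  IsFiniteMeasure μ ∧ Integrable w μ ∧
    ∀ z : ℂ, 0 < z.re → f z = ∫ s : ℝ≥0, Complex.exp (-(z * ((s : ℝ) : ℂ))) * w s ∂μ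

/-- The algebra of Laplace transforms of bounded complex measures on `[0, ∞)`, as functions on the
open right half-plane (values elsewhere are irrelevant). -/
def HPAlgebra : Set (ℂ → ℂ) :=
  {f | ∃ (μ : Measure ℝ≥0) (w : ℝ≥0 → ℂ), IsLaplaceTransformOn f μ w}

open Classical in
/-- The Hille-Phillips calculus: `f(A) x = ∫ e^{-sA} x (w μ)(ds)` if `f` is the Laplace transform
of `w μ`, for a bounded semigroup `T t = e^{-tA}`. The measure `w μ` is determined by `f`. -/
noncomputable def hpOp (T : C0Semigroup X) (f : ℂ → ℂ) : X →L[ℂ] X :=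
  if h : ∃ S : X →L[ℂ] X, ∃ (μ : Measure ℝ≥0) (w : ℝ≥0 → ℂ), IsLaplaceTransformOn f μ w ∧
      ∀ x : X, S x = ∫ s : ℝ≥0, w s • T.op s x ∂μ
  then h.choose else 0

/-- `e` is a regularizer for the holomorphic function `f` on the right half-plane: `e` and `e f`
belong to the Hille-Phillips algebra and `e(A)` is injective. -/
def IsRegularizer (T : C0Semigroup X) (f e : ℂ → ℂ) : Prop :=
  DifferentiableOn ℂ f {z : ℂ | 0 < z.re} ∧ e ∈ HPAlgebra ∧ (fun z => e z * f z) ∈ HPAlgebra ∧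
    Function.Injective (hpOp T e)

/-- The operator `e(A)⁻¹ (e f)(A)`, that is, the operator with graph
`{(x, y) | (e f)(A) x = e(A) y}`. -/
noncomputable def regularizedOp (T : C0Semigroup X) (f e : ℂ → ℂ) : X →ₗ.[ℂ] X :=
  (LinearMap.ker
    ((hpOp T (fun z => e z * f z) : X →ₗ[ℂ] X).comp (LinearMap.fst ℂ X X)
      - (hpOp T e : X →ₗ[ℂ] X).comp (LinearMap.snd ℂ X X))).toLinearPMap

open Classical in
/-- The extended Hille-Phillips calculus: `f(A) = e(A)⁻¹ (e f)(A)` for a regularizable `f`; this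
does not depend on the regularizer `e`. -/
noncomputable def extHPOp (T : C0Semigroup X) (f : ℂ → ℂ) : X →ₗ.[ℂ] X :=
  if h : ∃ e : ℂ → ℂ, IsRegularizer T f e then regularizedOp T f h.choose else ⊥

/-- For a regularizer `e`, the graph of `e(A)⁻¹ (e f)(A)` is what it should be. -/
theorem mem_regularizedOp_graph {T : C0Semigroup X} {f e : ℂ → ℂ} (h : IsRegularizer T f e)
    (x y : X) :
    (x, y) ∈ (regularizedOp T f e).graph ↔ hpOp T (fun z => e z * f z) x = hpOp T e y := by
  unfold regularizedOp
  rw [Submodule.toLinearPMap_graph_eq]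
  · simp [sub_eq_zero]
  · rintro ⟨a, b⟩ hp ha
    have ha' : a = 0 := ha
    subst ha'
    have hb : hpOp T e b = hpOp T e 0 := by simpa using hp
    exact h.2.2.2 hb

/-- The fractional power `A^{-α}` (principal branch), where `T t = e^{-tA}`. -/
noncomputable def negFractionalPower (T : C0Semigroup X) (α : ℝ) : X →ₗ.[ℂ] X :=
  extHPOp T (fun z : ℂ => z ^ (-(α : ℂ)))

/-- The composition `F D` of an unbounded operator `F` with a bounded operator `D` is everywhere
defined and equal to the bounded operator `S`. -/
def CompEqBounded (F : X →ₗ.[ℂ] X) (D S : X →L[ℂ] X) : Prop :=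
  ∀ x : X, ∃ h : D x ∈ F.domain, F ⟨D x, h⟩ = S x

end HillePhillips

/-! Put `F z = z ^ (-α) * (g (t z / n) ^ n - exp (-t z))`. The operator in question is `F(A)`, and
its norm dominates `|F(is)|` at every point `is` of the spectrum of `A` on the imaginary axis. So it
suffices to choose one good frequency `s`.

Let `ν` be the probability measure representing `g`. It has mean `1` and a finite second moment, and
it is not a point mass, since a point mass of mean `1` would give `exp (-z)`. Hence its
characteristic function satisfies `|φ(y)|² ≤ 1 - c y²` near `0`, and at `|y| = τ / √n` the power
`φ(y) ^ n` stays in a disc of radius smaller than `1`, uniformly in `n`. The exponential term has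
modulus one on the axis, so the difference is bounded below (`exists_le_norm_laplace_pow_sub`). By
hypothesis some spectral point has `|s| = τ √n / t`, which makes `t |s| / n = τ / √n`; there the
factor `|s| ^ (-α)` is at least `(t² / n) ^ (α / 2)` because `τ ≤ 1`.

Boundedness: Taylor's formula at `s = 1`, whose linear term has mean zero, shows that `(g(z) -
e^{-z}) / z²` is a Laplace transform of a bounded measure (`exists_hasHPRep_remainder`). Telescoping
carries this to `n`-th powers, and `z ^ (-α) = a + b / z²` with `a`, `b` in the Hille-Phillips
algebra (`exists_hasHPRep_cpow_neg_sq`). So `F` lies in the algebra, and `compEqBounded_extHPOp`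
identifies its operator with the composition.

Spectral inclusion (`HasHPRep.norm_le_of_mem_spectrum`): the open left half-plane is in the
resolvent set, so an imaginary spectral point is an approximate eigenvalue, and the semigroup acts
on approximate eigenvectors almost as `e^{-ist}`.

Existence of `ν` is Bernstein's theorem, obtained from the Hausdorff moment problem. Uniqueness of
Laplace transforms makes the choices hidden in `cmOp`, `hpOp` and `extHPOp` harmless, and turns
identities of symbols into identities of operators. -/

/-! ### The Hausdorff moment problem -/

section Hausdorff

open Polynomial unitInterval

/-- The linear functional on polynomials with prescribed moments. -/
noncomputable def momentFunctional (a : ℕ → ℝ) : ℝ[X] →ₗ[ℝ] ℝ :=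
  Polynomial.lsum fun j => a j • LinearMap.id

theorem momentFunctional_X_pow (a : ℕ → ℝ) (j : ℕ) : momentFunctional a (X ^ j) = a j := by
  simp [momentFunctional, Polynomial.lsum_apply, ← Polynomial.monomial_one_right_eq_X_pow,
    Polynomial.sum_monomial_index]

/-- Since `C(n,k) C(k,j) = C(n,j) C(n-j,k-j)`, the sum collapses to the partition of unity by
Bernstein polynomials of degree `n - j`. It expresses the `j`-th moment exactly through the
Bernstein weights. -/
theorem sum_choose_smul_bernsteinPolynomial (n j : ℕ) (hj : j ≤ n) :
    ∑ k ∈ Finset.range (n + 1), (k.choose j : ℝ) • bernsteinPolynomial ℝ n k =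
      (n.choose j : ℝ) • X ^ j := by
  obtain ⟨m, rfl⟩ := Nat.exists_eq_add_of_le hj
  rw [add_assoc, Finset.sum_range_add, Finset.sum_eq_zero, zero_add]
  · have h1 : ∀ i ∈ Finset.range (m + 1),
        ((j + i).choose j : ℝ) • bernsteinPolynomial ℝ (j + m) (j + i) =
          (((j + m).choose j : ℝ) • X ^ j) * bernsteinPolynomial ℝ m i := by
      intro i hi
      have hi' : i ≤ m := Nat.lt_succ_iff.1 (Finset.mem_range.1 hi)
      have h2 := Nat.choose_mul (n := j + m) (k := j + i) (s := j) (by omega)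
      have h4 : ((j + m).choose (j + i) : ℝ) * ((j + i).choose j : ℝ)
          = ((j + m).choose j : ℝ) * (m.choose i : ℝ) := by
        rw [show j + m - j = m by omega, show j + i - j = i by omega] at h2
        exact_mod_cast h2
      have h5 := congrArg (fun c : ℝ => C c) h4
      simp only [map_mul, map_natCast] at h5
      simp only [bernsteinPolynomial, smul_eq_C_mul, map_natCast]
      rw [show j + m - (j + i) = m - i by omega, pow_add]
      linear_combination (X ^ j * X ^ i * (1 - X) ^ (m - i)) * h5
    rw [Finset.sum_congr rfl h1, ← Finset.mul_sum, bernsteinPolynomial.sum, mul_one]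
  · intro i hi
    rw [Nat.choose_eq_zero_of_lt (Finset.mem_range.1 hi)]
    simp

/-- Passing from `j` to `j + 1` multiplies the quotient by `(k - j) / (n - j)`, which lies in `[0,
1]` and within `j / n` of `k / n`; the errors add up since `j² + j ≤ (j + 1)²`. Truncated
subtraction covers `k < j`. -/
theorem abs_choose_div_choose_sub_pow_le (n k : ℕ) (hk : k ≤ n) (j : ℕ) (hj : j ≤ n) :
    (k.choose j : ℝ) / n.choose j ≤ 1 ∧
      |(k.choose j : ℝ) / n.choose j - ((k : ℝ) / n) ^ j| ≤ (j : ℝ) * j / n := by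
  induction j with
  | zero => simp
  | succ j ih =>
    obtain ⟨ih1, ih2⟩ := ih (by omega)
    have hn : (0 : ℝ) < n := by exact_mod_cast (by omega : 0 < n)
    have hnj : (0 : ℝ) < (n : ℝ) - j := by
      have : (j : ℝ) < n := by exact_mod_cast (by omega : j < n)
      linarith
    have hkn : (k : ℝ) ≤ n := by exact_mod_cast hk
    have hj0 : (0 : ℝ) ≤ j := Nat.cast_nonneg j
    set b : ℝ := ((k - j : ℕ) : ℝ) / (n - j) with hb
    have hkj : (0 : ℝ) ≤ ((k - j : ℕ) : ℝ) := Nat.cast_nonneg _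
    have hstep : (k.choose (j + 1) : ℝ) / n.choose (j + 1) = (k.choose j : ℝ) / n.choose j * b := by
      have e1 : (k.choose (j + 1) : ℝ) * (j + 1) = k.choose j * ((k - j : ℕ) : ℝ) := by
        exact_mod_cast Nat.choose_succ_right_eq k j
      have e2 : (n.choose (j + 1) : ℝ) * (j + 1) = n.choose j * ((n : ℝ) - j) := by
        rw [← Nat.cast_sub (by omega : j ≤ n)]
        exact_mod_cast Nat.choose_succ_right_eq n j
      have p1 : (0 : ℝ) < n.choose (j + 1) := by exact_mod_cast Nat.choose_pos hj
      have p2 : (0 : ℝ) < n.choose j := by exact_mod_cast Nat.choose_pos (by omega : j ≤ n)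
      rw [hb, div_mul_div_comm, ← e1, ← e2]
      field_simp
    have hb0 : 0 ≤ b := by positivity
    have hb1 : b ≤ 1 := by
      rw [hb, div_le_one hnj]
      rcases le_total j k with h | h
      · rw [Nat.cast_sub h]; linarith
      · rw [Nat.sub_eq_zero_of_le h]; simp; linarith
    have hbx : |b - (k : ℝ) / n| ≤ j / n := by
      rcases le_total j k with h | h
      · have : b - (k : ℝ) / n = - ((j : ℝ) * (n - k) / (n * (n - j))) := by
          rw [hb, Nat.cast_sub h]; field_simp; ring
        rw [this, abs_neg, abs_of_nonneg (by
          apply div_nonneg (mul_nonneg hj0 (by linarith)) (by positivity))]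
        rw [div_le_div_iff₀ (by positivity) hn]
        have : (j : ℝ) ≤ k := by exact_mod_cast h
        have : (j : ℝ) * (n - k) * n ≤ j * (n - j) * n := by gcongr
        linarith
      · have : b = 0 := by rw [hb, Nat.sub_eq_zero_of_le h]; simp
        rw [this, zero_sub, abs_neg, abs_of_nonneg (by positivity)]
        have : (k : ℝ) ≤ j := by exact_mod_cast h
        gcongr
    have hq0 : 0 ≤ (k.choose j : ℝ) / n.choose j := by positivity
    have hx0 : 0 ≤ (k : ℝ) / n := by positivity
    have hx1 : (k : ℝ) / n ≤ 1 := by rw [div_le_one hn]; exact hkn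
    refine ⟨by rw [hstep]; nlinarith, ?_⟩
    rw [hstep, pow_succ]
    set q := (k.choose j : ℝ) / n.choose j
    set x := (k : ℝ) / n
    calc |q * b - x ^ j * x| = |(q - x ^ j) * x + q * (b - x)| := by ring_nf
      _ ≤ |q - x ^ j| * x + q * |b - x| := by
        refine (abs_add_le _ _).trans ?_
        rw [abs_mul, abs_mul, abs_of_nonneg hx0, abs_of_nonneg hq0]
      _ ≤ (j : ℝ) * j / n * 1 + 1 * (j / n) := by gcongr
      _ ≤ ((j + 1 : ℕ) : ℝ) * ((j + 1 : ℕ) : ℝ) / n := by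
        rw [mul_one, one_mul, ← add_div]
        push_cast
        gcongr
        nlinarith

/-- The Hausdorff moment theorem: a sequence whose iterated differences alternate in sign is the
sequence of moments of a measure on `[0, 1]`. -/
theorem exists_probabilityMeasure_moments (a : ℕ → ℝ) (h0 : a 0 = 1)
    (hpos : ∀ k m : ℕ, 0 ≤ momentFunctional a (X ^ k * (1 - X) ^ m)) :
    ∃ μ : ProbabilityMeasure I, ∀ j : ℕ, ∫ x : I, (x : ℝ) ^ j ∂(μ : Measure I) = a j := by
  -- The approximating measure of level `n` puts mass `w n k` at `k / n`. Its `j`-th moment differs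
  -- from `a j` by at most `j² / n`.
  set w : ℕ → ℕ → ℝ := fun n k => momentFunctional a (bernsteinPolynomial ℝ n k) with hw
  have hw0 : ∀ n k, 0 ≤ w n k := by
    intro n k
    have : bernsteinPolynomial ℝ n k = (n.choose k : ℝ) • (X ^ k * (1 - X) ^ (n - k)) := by
      simp [bernsteinPolynomial, smul_eq_C_mul, mul_assoc]
    rw [hw]
    simp only [this, map_smul, smul_eq_mul]
    exact mul_nonneg (Nat.cast_nonneg _) (hpos _ _)
  have hwm : ∀ n j, j ≤ n →
      ∑ k ∈ Finset.range (n + 1), (k.choose j : ℝ) / n.choose j * w n k = a j := by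
    intro n j hj
    have h1 := congrArg (momentFunctional a) (sum_choose_smul_bernsteinPolynomial n j hj)
    simp only [map_sum, map_smul, smul_eq_mul, momentFunctional_X_pow] at h1
    have p2 : (0 : ℝ) < n.choose j := by exact_mod_cast Nat.choose_pos hj
    simp only [div_mul_eq_mul_div]
    rw [← Finset.sum_div, div_eq_iff p2.ne', h1, mul_comm]
  have hw1 : ∀ n, ∑ k ∈ Finset.range (n + 1), w n k = 1 := by
    intro n
    have := hwm n 0 (Nat.zero_le n)
    simpa [h0] using this
  set pt : ℕ → ℕ → I := fun n k => Set.projIcc 0 1 zero_le_one ((k : ℝ) / n)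
  set M : ℕ → Measure I := fun n =>
    ∑ k ∈ Finset.range (n + 1), ENNReal.ofReal (w n k) • Measure.dirac (pt n k)
  have hM : ∀ n, IsProbabilityMeasure (M n) := by
    intro n
    constructor
    simp only [M, Measure.coe_finsetSum, Finset.sum_apply, Measure.smul_apply, measure_univ,
      smul_eq_mul, mul_one]
    rw [← ENNReal.ofReal_sum_of_nonneg (fun k _ => hw0 n k), hw1, ENNReal.ofReal_one]
  have hMint : ∀ n j, ∫ x : I, (x : ℝ) ^ j ∂(M n) =
      ∑ k ∈ Finset.range (n + 1), ((k : ℝ) / n) ^ j * w n k := by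
    intro n j
    rw [integral_finsetSum_measure]
    · refine Finset.sum_congr rfl fun k hk => ?_
      rw [integral_smul_measure, integral_dirac, ENNReal.toReal_ofReal (hw0 n k), smul_eq_mul,
        mul_comm]
      congr 2
      have hkn : (k : ℝ) ≤ n := by exact_mod_cast Nat.lt_succ_iff.1 (Finset.mem_range.1 hk)
      have : (k : ℝ) / n ∈ Icc (0 : ℝ) 1 :=
        ⟨by positivity, div_le_one_of_le₀ hkn (Nat.cast_nonneg n)⟩
      simp [pt, Set.projIcc_of_mem _ this]
    · intro k _
      refine Integrable.smul_measure ?_ ENNReal.ofReal_ne_top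
      exact (integrable_dirac (by simp))
  have hlim : ∀ j, Tendsto (fun n => ∫ x : I, (x : ℝ) ^ j ∂(M n)) atTop (𝓝 (a j)) := by
    intro j
    rw [tendsto_iff_norm_sub_tendsto_zero]
    refine squeeze_zero' (Eventually.of_forall fun n => norm_nonneg _) ?_
      (tendsto_const_div_atTop_nhds_zero_nat ((j : ℝ) * j))
    filter_upwards [eventually_ge_atTop j] with n hn
    rw [hMint, ← hwm n j hn, ← Finset.sum_sub_distrib]
    calc ‖∑ k ∈ Finset.range (n + 1),
          (((k : ℝ) / n) ^ j * w n k - (k.choose j : ℝ) / n.choose j * w n k)‖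
        ≤ ∑ k ∈ Finset.range (n + 1), (j : ℝ) * j / n * w n k := by
          refine norm_sum_le_of_le _ fun k hk => ?_
          rw [← sub_mul, norm_mul, Real.norm_of_nonneg (hw0 n k), norm_sub_rev]
          exact mul_le_mul_of_nonneg_right (abs_choose_div_choose_sub_pow_le n k
            (Nat.lt_succ_iff.1 (Finset.mem_range.1 hk)) j hn).2 (hw0 n k)
      _ = (j : ℝ) * j / n := by rw [← Finset.mul_sum, hw1, mul_one]
  let PM : ℕ → ProbabilityMeasure I := fun n => ⟨M n, hM n⟩
  -- Probability measures on a compact space are weakly compact. An ultrafilter limit replaces the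
  -- extraction of a convergent subsequence.
  obtain ⟨μ, -, hμ⟩ := (isCompact_univ (X := ProbabilityMeasure I)).ultrafilter_le_nhds
    ((hyperfilter ℕ).map PM) (by simp)
  refine ⟨μ, fun j => ?_⟩
  have hconv : Tendsto PM (hyperfilter ℕ) (𝓝 μ) := hμ
  rw [ProbabilityMeasure.tendsto_iff_forall_integral_tendsto] at hconv
  have h1 := hconv (BoundedContinuousFunction.mkOfCompact ⟨fun x : I => (x : ℝ) ^ j, by fun_prop⟩)
  have h2 : Tendsto (fun n => ∫ x : I, (x : ℝ) ^ j ∂(M n)) (hyperfilter ℕ) (𝓝 (a j)) :=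
    (hlim j).mono_left (hyperfilter_le_cofinite.trans Nat.cofinite_eq_atTop.le)
  exact tendsto_nhds_unique h1 h2

/-- A finite measure on `[0, 1]` is determined by its moments. -/
theorem ext_of_moments (μ ν : Measure I) [IsFiniteMeasure μ] [IsFiniteMeasure ν]
    (h : ∀ j : ℕ, ∫ x : I, (x : ℝ) ^ j ∂μ = ∫ x : I, (x : ℝ) ^ j ∂ν) : μ = ν := by
  have hint : ∀ (ρ : Measure I) [IsFiniteMeasure ρ] (f : C(I, ℝ)), Integrable f ρ := by
    intro ρ _ f
    exact (BoundedContinuousFunction.mkOfCompact f).integrable ρ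
  have hpint : ∀ (ρ : Measure I) [IsFiniteMeasure ρ] (p : ℝ[X]),
      Integrable (fun x : I => p.eval (x : ℝ)) ρ :=
    fun ρ _ p => hint ρ (p.toContinuousMapOn I)
  have hpoly : ∀ p : ℝ[X], ∫ x : I, p.eval (x : ℝ) ∂μ = ∫ x : I, p.eval (x : ℝ) ∂ν := by
    intro p
    induction p using Polynomial.induction_on' with
    | add p q hp hq =>
      simp only [eval_add]
      rw [integral_add (hpint μ p) (hpint μ q), integral_add (hpint ν p) (hpint ν q), hp, hq]
    | monomial n c =>
      simp only [eval_monomial, integral_const_mul, h]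
  refine ext_of_forall_integral_eq_of_IsFiniteMeasure fun f => ?_
  refine eq_of_forall_dist_le fun ε hε => ?_
  -- The summand `1` keeps `K` positive even if both measures vanish.
  set K : ℝ := μ.real univ + ν.real univ + 1
  have hK : 0 < K := by positivity
  obtain ⟨p, hp⟩ := exists_polynomial_near_continuousMap 0 1 f.toContinuousMap (ε / K) (by positivity)
  have hb : ∀ (ρ : Measure I) (_ : IsFiniteMeasure ρ),
      |∫ x, f x ∂ρ - ∫ x : I, p.eval (x : ℝ) ∂ρ| ≤ ε / K * ρ.real univ := by
    intro ρ _
    rw [← integral_sub (f.integrable ρ) (hpint ρ p), ← Real.norm_eq_abs]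
    refine norm_integral_le_of_norm_le_const (μ := ρ) (C := ε / K)
      (Eventually.of_forall fun x => ?_)
    have := (ContinuousMap.norm_coe_le_norm (p.toContinuousMapOn I - f.toContinuousMap) x).trans hp.le
    rw [norm_sub_rev]
    exact this
  have h1 := hb μ inferInstance
  have h2 := hb ν inferInstance
  rw [hpoly p] at h1
  rw [Real.dist_eq]
  calc |∫ x, f x ∂μ - ∫ x, f x ∂ν| ≤ ε / K * μ.real univ + ε / K * ν.real univ := by
        rw [abs_le] at *; constructor <;> linarith [h1.1, h1.2, h2.1, h2.2]
    _ ≤ ε / K * K := by rw [← mul_add]; gcongr; simp [K]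
    _ = ε := by field_simp

end Hausdorff

/-! ### Bernstein's theorem -/

section Bernstein

open Polynomial unitInterval

/-- Multiplication by `1 - X` is dual to the backward difference of the sequence. Hence positivity
on `X ^ k * (1 - X) ^ m` can be proved by differencing `m` times. -/
theorem momentFunctional_one_sub_X_mul (a : ℕ → ℝ) (p : ℝ[X]) :
    momentFunctional a ((1 - X) * p) = momentFunctional (fun j => a j - a (j + 1)) p := by
  induction p using Polynomial.induction_on' with
  | add p q hp hq => rw [mul_add, map_add, map_add, hp, hq]
  | monomial n c =>
    rw [← smul_X_eq_monomial, mul_smul_comm, map_smul, map_smul, sub_mul, one_mul, map_sub,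
      ← pow_succ', momentFunctional_X_pow, momentFunctional_X_pow, momentFunctional_X_pow]

namespace IsCompletelyMonotone

variable {g : ℝ → ℝ}

theorem contDiffAt (hg : IsCompletelyMonotone g) {t : ℝ} (ht : 0 < t) : ContDiffAt ℝ ∞ g t :=
  hg.1.contDiffAt (Ioi_mem_nhds ht)

theorem hasDerivAt_iteratedDeriv (hg : IsCompletelyMonotone g) (n : ℕ) {t : ℝ} (ht : 0 < t) :
    HasDerivAt (iteratedDeriv n g) (iteratedDeriv (n + 1) g t) t := by
  rw [iteratedDeriv_succ]
  refine DifferentiableAt.hasDerivAt ?_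
  have h1 : iteratedDeriv n g =ᶠ[𝓝 t] iteratedDerivWithin n g (Ioi 0) := by
    filter_upwards [Ioi_mem_nhds ht] with x hx
    exact (iteratedDerivWithin_of_isOpen isOpen_Ioi hx).symm
  have h2 : DifferentiableWithinAt ℝ (iteratedDerivWithin n g (Ioi 0)) (Ioi 0) t :=
    hg.1.differentiableOn_iteratedDerivWithin (by exact_mod_cast WithTop.coe_lt_top n)
      (uniqueDiffOn_Ioi 0) t ht
  exact (h2.differentiableAt (Ioi_mem_nhds ht)).congr_of_eventuallyEq h1

theorem antitoneOn (hg : IsCompletelyMonotone g) (n : ℕ) :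
    AntitoneOn (fun t => (-1 : ℝ) ^ n * iteratedDeriv n g t) (Ioi 0) := by
  have hd : ∀ t : ℝ, 0 < t → HasDerivAt (fun t => (-1 : ℝ) ^ n * iteratedDeriv n g t)
      ((-1 : ℝ) ^ n * iteratedDeriv (n + 1) g t) t :=
    fun t ht => (hg.hasDerivAt_iteratedDeriv n ht).const_mul _
  refine antitoneOn_of_deriv_nonpos (convex_Ioi 0)
    (fun t ht => (hd t ht).continuousAt.continuousWithinAt)
    (fun t ht => ?_) (fun t ht => ?_)
  · rw [interior_Ioi] at ht
    exact (hd t ht).differentiableAt.differentiableWithinAt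
  · rw [interior_Ioi] at ht
    rw [(hd t ht).deriv]
    have := hg.2 (n + 1) t ht
    rw [pow_succ] at this
    linarith

theorem sub_shift (hg : IsCompletelyMonotone g) {h : ℝ} (hh : 0 ≤ h) :
    IsCompletelyMonotone fun t => g t - g (t + h) := by
  have hs : ∀ t : ℝ, 0 < t → ContDiffAt ℝ ∞ (fun t => g (t + h)) t := fun t ht =>
    ContDiffAt.comp t (hg.contDiffAt (by linarith)) (by fun_prop)
  refine ⟨fun t ht => ((hg.contDiffAt ht).sub (hs t ht)).contDiffWithinAt, fun n t ht => ?_⟩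
  have h1 : iteratedDeriv n (fun t => g t - g (t + h)) t
      = iteratedDeriv n g t - iteratedDeriv n g (t + h) := by
    have := iteratedDeriv_sub (n := n) ((hg.contDiffAt ht).of_le (by exact_mod_cast le_top))
      ((hs t ht).of_le (by exact_mod_cast le_top))
    rw [iteratedDeriv_comp_add_const] at this
    exact this
  rw [h1, mul_sub]
  have := hg.antitoneOn n (show t ∈ Ioi 0 from ht) (show t + h ∈ Ioi 0 from by
    simp only [mem_Ioi] at *; linarith) (by linarith)
  simp only at this
  linarith

/-- Each factor `1 - X` replaces `g` by `g - g(· + h)`, which is again completely monotone; the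
induction therefore runs over all `g`. The offset `x > 0` avoids the uncontrolled value of `g` at
`0`. -/
theorem momentFunctional_nonneg (hg : IsCompletelyMonotone g) {x h : ℝ} (hx : 0 < x) (hh : 0 ≤ h)
    (k m : ℕ) : 0 ≤ momentFunctional (fun j => g (x + j * h)) (X ^ k * (1 - X) ^ m) := by
  induction m generalizing g with
  | zero =>
    rw [pow_zero, mul_one, momentFunctional_X_pow]
    simpa using hg.2 0 (x + k * h) (by positivity)
  | succ m ih =>
    rw [pow_succ', mul_left_comm, momentFunctional_one_sub_X_mul]
    convert ih (hg.sub_shift hh) using 4 with j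
    push_cast
    ring_nf

theorem continuousOn (hg : IsCompletelyMonotone g) : ContinuousOn g (Ioi 0) := hg.1.continuousOn

/-- The moments of a completely monotone function with `g(0+) = 1` along an arithmetic
progression. -/
theorem exists_moments (hg : IsCompletelyMonotone g) (h0 : Tendsto g (𝓝[>] 0) (𝓝 1)) {h : ℝ}
    (hh : 0 < h) :
    ∃ μ : ProbabilityMeasure I, ∀ j : ℕ, 0 < j → ∫ x : I, (x : ℝ) ^ j ∂(μ : Measure I) = g (j * h) := by
  set a : ℕ → ℝ := fun j => if j = 0 then 1 else g (j * h) with ha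
  obtain ⟨μ, hμ⟩ := exists_probabilityMeasure_moments a (by simp [ha]) (fun k m => by
    -- Positivity is known for the sequence started at `x > 0`. Letting `x → 0+` turns its entry of
    -- index `0` into `g(0+) = 1`, which is why `a 0` is set to `1`.
    have hlim : ∀ p : ℝ[X], Tendsto (fun x : ℝ => momentFunctional (fun j => g (x + j * h)) p)
        (𝓝[>] 0) (𝓝 (momentFunctional a p)) := by
      intro p
      induction p using Polynomial.induction_on' with
      | add p q hp hq => simpa only [map_add] using hp.add hq
      | monomial n c =>
        simp only [← smul_X_eq_monomial, map_smul, momentFunctional_X_pow]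
        refine Tendsto.const_smul ?_ c
        rcases Nat.eq_zero_or_pos n with rfl | hn
        · simpa [ha] using h0
        · have hn' : (0 : ℝ) < n * h := by positivity
          have hc : ContinuousAt g (0 + n * h) := by
            rw [zero_add]; exact (hg.contDiffAt hn').continuousAt
          have : Tendsto (fun x : ℝ => g (x + n * h)) (𝓝 0) (𝓝 (g (0 + n * h))) :=
            ContinuousAt.tendsto (x := (0 : ℝ)) (ContinuousAt.comp (f := fun x : ℝ => x + n * h) hc
              (by fun_prop))
          simpa [ha, hn.ne'] using this.mono_left nhdsWithin_le_nhds
    refine ge_of_tendsto (hlim _) ?_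
    filter_upwards [self_mem_nhdsWithin] with x hx
    exact hg.momentFunctional_nonneg hx hh.le k m)
  exact ⟨μ, fun j hj => by rw [hμ]; simp [ha, hj.ne']⟩

/-- Bernstein's theorem on `[0, 1]`. -/
theorem exists_integral_rpow (hg : IsCompletelyMonotone g) (h0 : Tendsto g (𝓝[>] 0) (𝓝 1)) :
    ∃ μ : ProbabilityMeasure I, ∀ t : ℝ, 0 < t → g t = ∫ x : I, (x : ℝ) ^ t ∂(μ : Measure I) := by
  obtain ⟨μ, hμ⟩ := hg.exists_moments h0 one_pos
  refine ⟨μ, ?_⟩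
  have hcp : ∀ (x : I) (n : ℕ), ((x ^ n : I) : ℝ) = (x : ℝ) ^ n := fun _ _ => rfl
  have hrat : ∀ q : ℚ, 0 < (q : ℝ) → g q = ∫ x : I, (x : ℝ) ^ (q : ℝ) ∂(μ : Measure I) := by
    intro q hq
    have hd : (0 : ℝ) < q.den := by exact_mod_cast q.den_pos
    obtain ⟨ρ, hρ⟩ := hg.exists_moments h0 (h := 1 / (q.den : ℝ)) (by positivity)
    have hpow : Continuous fun x : I => x ^ q.den := by fun_prop
    -- The measure for step `1 / q.den`, pushed forward by the power `q.den`, has the integer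
    -- moments of `μ`, so it is `μ`. This gives the values of `g` at rational points through the
    -- single measure `μ`.
    have hmap : (ρ : Measure I).map (fun x : I => x ^ q.den) = μ := by
      have : IsFiniteMeasure ((ρ : Measure I).map (fun x : I => x ^ q.den)) :=
        Measure.isFiniteMeasure_map _ _
      refine ext_of_moments _ _ fun j => ?_
      rw [integral_map hpow.aemeasurable (by fun_prop)]
      rcases Nat.eq_zero_or_pos j with rfl | hj
      · simp
      · rw [hμ j hj]
        simp only [hcp, ← pow_mul]
        rw [hρ _ (Nat.mul_pos q.den_pos hj)]
        push_cast
        congr 1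
        field_simp
    have hqn : 0 < q.num := Rat.num_pos.2 (by exact_mod_cast hq)
    obtain ⟨a, ha⟩ := Int.eq_ofNat_of_zero_le hqn.le
    have ha0 : 0 < a := by omega
    have hqa : (q : ℝ) = (a : ℝ) / q.den := by
      rw [Rat.cast_def, ha]; simp
    rw [← hmap, integral_map hpow.aemeasurable]
    · have h1 := hρ a ha0
      rw [hqa, mul_one_div] at *
      rw [← h1]
      refine integral_congr_ae (Eventually.of_forall fun x => ?_)
      simp only [hcp]
      rw [← Real.rpow_natCast (x : ℝ) a, ← Real.rpow_natCast (x : ℝ) q.den, ← Real.rpow_mul x.2.1]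
      congr 1
      field_simp
    · have : Continuous fun x : I => (x : ℝ) ^ (q : ℝ) :=
        continuous_subtype_val.rpow_const fun _ => Or.inr hq.le
      exact this.aestronglyMeasurable
  have hcont : ContinuousOn (fun t : ℝ => ∫ x : I, (x : ℝ) ^ t ∂(μ : Measure I)) (Ioi 0) := by
    refine continuousOn_of_dominated (bound := fun _ => 1) ?_ ?_ (integrable_const _) ?_
    · intro t ht
      have : Continuous fun x : I => (x : ℝ) ^ t :=
        continuous_subtype_val.rpow_const fun _ => Or.inr (le_of_lt ht)
      exact this.aestronglyMeasurable
    · intro t ht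
      refine Eventually.of_forall fun x => ?_
      rw [Real.norm_of_nonneg (Real.rpow_nonneg x.2.1 _)]
      exact Real.rpow_le_one x.2.1 x.2.2 (le_of_lt ht)
    · refine Eventually.of_forall fun x t ht => ?_
      exact (Real.continuousAt_const_rpow' (ne_of_gt ht)).continuousWithinAt
  have hdense : Ioi (0 : ℝ) ⊆ closure (Ioi 0 ∩ range ((↑) : ℚ → ℝ)) :=
    Rat.denseRange_cast.open_subset_closure_inter isOpen_Ioi
  intro t ht
  refine Set.EqOn.of_subset_closure (s := Ioi 0 ∩ range ((↑) : ℚ → ℝ)) (t := Ioi 0) ?_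
    hg.continuousOn hcont inter_subset_left hdense ht
  rintro _ ⟨hq, q, rfl⟩
  exact hrat q hq

/-- Bernstein's theorem: a completely monotone function with `g(0+) = 1` is the Laplace transform
of a probability measure. -/
theorem exists_isLaplaceTransformOf (hg : IsCompletelyMonotone g)
    (h0 : Tendsto g (𝓝[>] 0) (𝓝 1)) :
    ∃ ν : Measure ℝ≥0, IsFiniteMeasure ν ∧ IsLaplaceTransformOf g ν := by
  obtain ⟨μ, hμ⟩ := hg.exists_integral_rpow h0
  set φ : I → ℝ≥0 := fun x => Real.toNNReal (-Real.log x) with hφ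
  have hφm : Measurable φ := by fun_prop
  -- As `t → 0+`, the integral of `x ^ t` tends to the mass off `0`, while it equals `g t → 1`; so
  -- there is no atom at `0`. This is needed because `φ 0 = 0` only by the convention `Real.log 0 =
  -- 0`.
  have hzero : ∀ᵐ x : I ∂(μ : Measure I), (x : ℝ) ≠ 0 := by
    have h1 : Tendsto (fun t : ℝ => ∫ x : I, (x : ℝ) ^ t ∂(μ : Measure I)) (𝓝[>] 0)
        (𝓝 (∫ x : I, (if (x : ℝ) = 0 then 0 else 1) ∂(μ : Measure I))) := by
      refine tendsto_integral_filter_of_dominated_convergence (fun _ => 1) ?_ ?_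
        (integrable_const _) ?_
      · filter_upwards [self_mem_nhdsWithin] with t ht
        have : Continuous fun x : I => (x : ℝ) ^ t :=
          continuous_subtype_val.rpow_const fun _ => Or.inr (le_of_lt ht)
        exact this.aestronglyMeasurable
      · filter_upwards [self_mem_nhdsWithin] with t ht
        refine Eventually.of_forall fun x => ?_
        rw [Real.norm_of_nonneg (Real.rpow_nonneg x.2.1 _)]
        exact Real.rpow_le_one x.2.1 x.2.2 (le_of_lt ht)
      · refine Eventually.of_forall fun x => ?_
        split_ifs with hx
        · refine tendsto_const_nhds.congr' ?_
          filter_upwards [self_mem_nhdsWithin] with t ht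
          rw [hx, Real.zero_rpow (ne_of_gt ht)]
        · have := (Real.continuousAt_const_rpow (b := 0) hx).tendsto
          rw [Real.rpow_zero] at this
          exact this.mono_left nhdsWithin_le_nhds
    have h2 : ∫ x : I, (if (x : ℝ) = 0 then (0 : ℝ) else 1) ∂(μ : Measure I) = 1 := by
      refine tendsto_nhds_unique h1 (h0.congr' ?_)
      filter_upwards [self_mem_nhdsWithin] with t ht
      exact hμ t ht
    have hmeas : MeasurableSet {x : I | (x : ℝ) = 0} :=
      measurableSet_eq_fun measurable_subtype_coe measurable_const
    have hi : Integrable (fun x : I => if (x : ℝ) = 0 then (0 : ℝ) else 1) (μ : Measure I) :=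
      (integrable_const (1 : ℝ)).mono'
        (Measurable.ite hmeas measurable_const measurable_const).aestronglyMeasurable
        (Eventually.of_forall fun x => by split_ifs <;> simp)
    have h3 : ∫ x : I, (1 - (if (x : ℝ) = 0 then (0 : ℝ) else 1)) ∂(μ : Measure I) = 0 := by
      rw [integral_sub (integrable_const _) hi, h2]
      simp
    have h4 := (integral_eq_zero_iff_of_nonneg
      (f := fun x : I => 1 - (if (x : ℝ) = 0 then (0 : ℝ) else 1)) (fun x => by
        simp only [Pi.zero_apply]; split_ifs <;> simp) ((integrable_const _).sub hi)).1 h3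
    filter_upwards [h4] with x hx hx0
    simp [hx0] at hx
  refine ⟨(μ : Measure I).map φ, Measure.isFiniteMeasure_map _ _, fun t ht => ?_⟩
  rw [hμ t ht, integral_map hφm.aemeasurable (by fun_prop)]
  refine integral_congr_ae ?_
  filter_upwards [hzero] with x hx
  have hx0 : 0 < (x : ℝ) := lt_of_le_of_ne x.2.1 (Ne.symm hx)
  rw [Real.rpow_def_of_pos hx0, hφ, Real.coe_toNNReal _ (by
    have := Real.log_nonpos x.2.1 x.2.2
    linarith)]
  ring_nf

end IsCompletelyMonotone

end Bernstein

/-! ### Uniqueness of Laplace transforms, and integrals against complex measures -/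

section LaplaceUniqueness

open unitInterval

theorem Continuous.integrable_of_norm_le {E : Type*} [NormedAddCommGroup E] {F : ℝ≥0 → E}
    (hF : Continuous F) {C : ℝ} (hC : ∀ s, ‖F s‖ ≤ C) (m : Measure ℝ≥0) [IsFiniteMeasure m] :
    Integrable F m :=
  Integrable.of_bound hF.aestronglyMeasurable C (Eventually.of_forall hC)

theorem norm_cexp_neg_mul_le {z : ℂ} (hz : 0 ≤ z.re) (s : ℝ≥0) :
    ‖Complex.exp (-(z * ((s : ℝ) : ℂ)))‖ ≤ 1 := by
  rw [Complex.norm_exp, Real.exp_le_one_iff]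
  simp only [Complex.neg_re, Complex.mul_re, Complex.ofReal_re, Complex.ofReal_im, mul_zero,
    sub_zero, Left.neg_nonpos_iff]
  positivity

theorem continuous_cexp_neg_mul (z : ℂ) :
    Continuous fun s : ℝ≥0 => Complex.exp (-(z * ((s : ℝ) : ℂ))) := by
  fun_prop

/-- The Laplace transform is continuous up to the imaginary axis. -/
theorem continuousOn_laplace (m : Measure ℝ≥0) [IsFiniteMeasure m] :
    ContinuousOn (fun z : ℂ => ∫ s : ℝ≥0, Complex.exp (-(z * ((s : ℝ) : ℂ))) ∂m)
      {z : ℂ | 0 ≤ z.re} :=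
  continuousOn_of_dominated (bound := fun _ => 1)
    (fun z _ => (continuous_cexp_neg_mul z).aestronglyMeasurable)
    (fun _ hz => Eventually.of_forall fun s => norm_cexp_neg_mul_le hz s) (integrable_const _)
    (Eventually.of_forall fun s => Continuous.continuousOn (by fun_prop))

theorem tendsto_imaginary_add (r : ℝ) :
    Tendsto (fun δ : ℝ => Complex.I * r + δ) (𝓝[>] 0) (𝓝[{z : ℂ | 0 ≤ z.re}] (Complex.I * r)) := by
  refine tendsto_nhdsWithin_iff.2 ⟨?_, ?_⟩
  · have : Tendsto (fun δ : ℝ => Complex.I * r + δ) (𝓝 0) (𝓝 (Complex.I * r + (0 : ℝ))) :=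
      Continuous.tendsto (by fun_prop) 0
    rw [Complex.ofReal_zero, add_zero] at this
    exact this.mono_left nhdsWithin_le_nhds
  · filter_upwards [self_mem_nhdsWithin] with δ hδ
    simpa using le_of_lt hδ

theorem tendsto_integral_exp_neg_mul_zero (m : Measure ℝ≥0) [IsFiniteMeasure m] :
    Tendsto (fun t : ℝ => ∫ s : ℝ≥0, Real.exp (-(t * (s : ℝ))) ∂m) (𝓝[>] 0)
      (𝓝 (m.real univ)) := by
  have h : Tendsto (fun t : ℝ => ∫ s : ℝ≥0, Real.exp (-(t * (s : ℝ))) ∂m) (𝓝[>] 0)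
      (𝓝 (∫ _ : ℝ≥0, (1 : ℝ) ∂m)) := by
    refine tendsto_integral_filter_of_dominated_convergence (fun _ => 1) ?_ ?_
      (integrable_const _) ?_
    · exact Eventually.of_forall fun t => by fun_prop
    · filter_upwards [self_mem_nhdsWithin] with t ht
      refine Eventually.of_forall fun s => ?_
      have ht' : 0 ≤ t := le_of_lt ht
      rw [Real.norm_of_nonneg (Real.exp_pos _).le, Real.exp_le_one_iff]
      simp only [Left.neg_nonpos_iff]
      positivity
    · refine Eventually.of_forall fun s => ?_
      have : Tendsto (fun t : ℝ => Real.exp (-(t * (s : ℝ)))) (𝓝 0) (𝓝 (Real.exp (-(0 * (s : ℝ))))) :=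
        Continuous.tendsto (by fun_prop) 0
      simpa using this.mono_left nhdsWithin_le_nhds
  simpa using h

/-- A finite measure on `[0, ∞)` is determined by its Laplace transform. -/
theorem ext_of_laplace {m m' : Measure ℝ≥0} [IsFiniteMeasure m] [IsFiniteMeasure m']
    (h : ∀ t : ℝ, 0 < t → ∫ s : ℝ≥0, Real.exp (-(t * (s : ℝ))) ∂m =
      ∫ s : ℝ≥0, Real.exp (-(t * (s : ℝ))) ∂m') : m = m' := by
  set ψ : ℝ≥0 → I := fun s => ⟨Real.exp (-(s : ℝ)), (Real.exp_pos _).le, by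
    rw [Real.exp_le_one_iff]; simp⟩ with hψ
  have hψm : Measurable ψ := by fun_prop
  set φ : I → ℝ≥0 := fun x => Real.toNNReal (-Real.log x)
  have hφm : Measurable φ := by fun_prop
  have hφψ : φ ∘ ψ = id := by
    ext s
    simp [φ, hψ]
  -- The hypothesis covers only `t > 0`, so the zeroth moment has to be recovered as a limit.
  have hmass : m.real univ = m'.real univ := by
    refine tendsto_nhds_unique (tendsto_integral_exp_neg_mul_zero m)
      ((tendsto_integral_exp_neg_mul_zero m').congr' ?_)
    filter_upwards [self_mem_nhdsWithin] with t ht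
    exact (h t ht).symm
  have h1 : m.map ψ = m'.map ψ := by
    have := Measure.isFiniteMeasure_map m ψ
    have := Measure.isFiniteMeasure_map m' ψ
    refine ext_of_moments _ _ fun j => ?_
    rw [integral_map hψm.aemeasurable (by fun_prop), integral_map hψm.aemeasurable (by fun_prop)]
    rcases Nat.eq_zero_or_pos j with rfl | hj
    · simpa using hmass
    · have h2 : ∀ s : ℝ≥0, ((ψ s : I) : ℝ) ^ j = Real.exp (-((j : ℝ) * (s : ℝ))) := by
        intro s
        rw [hψ, ← Real.exp_nat_mul]
        ring_nf
      simp only [h2]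
      exact h j (by exact_mod_cast hj)
  have h2 := congrArg (fun ρ => Measure.map φ ρ) h1
  simp only [Measure.map_map hφm hψm, hφψ, Measure.map_id] at h2
  exact h2

variable {E : Type*} [NormedAddCommGroup E] [NormedSpace ℂ E]

theorem isFiniteMeasure_sum_ofReal_smul {ι : Type*} [Fintype ι] (b : ι → ℝ)
    (m : ι → Measure ℝ≥0) [∀ i, IsFiniteMeasure (m i)] :
    IsFiniteMeasure (∑ i, ENNReal.ofReal (b i) • m i) := by
  have : ∀ i, IsFiniteMeasure (ENNReal.ofReal (b i) • m i) :=
    fun i => Measure.smul_finite _ ENNReal.ofReal_ne_top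
  infer_instance

theorem sum_real_smul_integral_eq_sub {ι : Type*} [Fintype ι] (a : ι → ℝ) (m : ι → Measure ℝ≥0)
    [∀ i, IsFiniteMeasure (m i)] {G : Type*} [NormedAddCommGroup G] [NormedSpace ℝ G]
    {F : ℝ≥0 → G} (hF : Continuous F) {C : ℝ} (hC : ∀ s, ‖F s‖ ≤ C) :
    ∑ i, a i • ∫ s, F s ∂(m i) = ∫ s, F s ∂(∑ i, ENNReal.ofReal (a i) • m i) -
      ∫ s, F s ∂(∑ i, ENNReal.ofReal (-a i) • m i) := by
  have hs : ∀ b : ι → ℝ, ∫ s, F s ∂(∑ i, ENNReal.ofReal (b i) • m i)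
      = ∑ i, max (b i) 0 • ∫ s, F s ∂(m i) := by
    intro b
    rw [integral_finsetSum_measure]
    · refine Finset.sum_congr rfl fun i _ => ?_
      rw [integral_smul_measure, ENNReal.toReal_ofReal']
    · intro i _
      exact (hF.integrable_of_norm_le hC (m i)).smul_measure ENNReal.ofReal_ne_top
  rw [hs, hs, ← Finset.sum_sub_distrib]
  refine Finset.sum_congr rfl fun i _ => ?_
  rw [← sub_smul, max_zero_sub_eq_self]

/-- Collecting positive and negative coefficients gives two finite positive measures with equal
Laplace transforms. They coincide by `ext_of_laplace`, so no signed measures are needed. -/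
theorem sum_real_smul_integral_eq_zero {ι : Type*} [Fintype ι] (a : ι → ℝ) (m : ι → Measure ℝ≥0)
    [∀ i, IsFiniteMeasure (m i)]
    (h : ∀ t : ℝ, 0 < t → ∑ i, a i * ∫ s : ℝ≥0, Real.exp (-(t * (s : ℝ))) ∂(m i) = 0)
    {G : Type*} [NormedAddCommGroup G] [NormedSpace ℝ G]
    {F : ℝ≥0 → G} (hF : Continuous F) {C : ℝ} (hC : ∀ s, ‖F s‖ ≤ C) :
    ∑ i, a i • ∫ s, F s ∂(m i) = 0 := by
  have := isFiniteMeasure_sum_ofReal_smul a m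
  have := isFiniteMeasure_sum_ofReal_smul (fun i => -a i) m
  have hPN : (∑ i, ENNReal.ofReal (a i) • m i) = ∑ i, ENNReal.ofReal (-a i) • m i := by
    refine ext_of_laplace fun t ht => ?_
    have h1 := sum_real_smul_integral_eq_sub a m
      (F := fun s : ℝ≥0 => Real.exp (-(t * (s : ℝ)))) (by fun_prop) (C := 1) (fun s => by
      rw [Real.norm_of_nonneg (Real.exp_pos _).le, Real.exp_le_one_iff]
      simp only [Left.neg_nonpos_iff]
      positivity)
    simp only [smul_eq_mul] at h1
    rw [h t ht] at h1
    exact (sub_eq_zero.1 h1.symm)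
  rw [sum_real_smul_integral_eq_sub a m hF hC, hPN, sub_self]

/-- A complex combination of finite measures whose Laplace transform vanishes is zero. -/
theorem sum_smul_integral_eq_zero {ι : Type*} [Fintype ι] (c : ι → ℂ) (m : ι → Measure ℝ≥0)
    [∀ i, IsFiniteMeasure (m i)]
    (h : ∀ z : ℂ, 0 < z.re → ∑ i, c i * ∫ s : ℝ≥0, Complex.exp (-(z * ((s : ℝ) : ℂ))) ∂(m i) = 0)
    {F : ℝ≥0 → E} (hF : Continuous F) {C : ℝ} (hC : ∀ s, ‖F s‖ ≤ C) :
    ∑ i, c i • ∫ s, F s ∂(m i) = 0 := by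
  have hr : ∀ t : ℝ, 0 < t →
      ∑ i, c i * ((∫ s : ℝ≥0, Real.exp (-(t * (s : ℝ))) ∂(m i) : ℝ) : ℂ) = 0 := by
    intro t ht
    rw [← h (t : ℂ) (by simpa using ht)]
    refine Finset.sum_congr rfl fun i _ => ?_
    rw [← integral_complex_ofReal]
    push_cast
    rfl
  have hre := sum_real_smul_integral_eq_zero (fun i => (c i).re) m (fun t ht => by
    have := congrArg Complex.re (hr t ht)
    simpa using this) hF hC
  have him := sum_real_smul_integral_eq_zero (fun i => (c i).im) m (fun t ht => by
    have := congrArg Complex.im (hr t ht)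
    simpa using this) hF hC
  have : ∀ (z : ℂ) (v : E), z • v = z.re • v + Complex.I • (z.im • v) := by
    intro z v
    conv_lhs => rw [← Complex.re_add_im z]
    rw [add_smul, mul_comm, mul_smul, Complex.coe_smul, Complex.coe_smul]
  simp only [this (c _)]
  rw [Finset.sum_add_distrib, ← Finset.smul_sum, hre, him, smul_zero, add_zero]

/-- Four nonnegative functions whose combination with coefficients `1, -1, i, -i` is `v`. -/
def complexParts {Ω : Type*} (v : Ω → ℂ) : Fin 4 → Ω → ℝ :=
  ![fun y => (v y).re, fun y => -(v y).re, fun y => (v y).im, fun y => -(v y).im]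

theorem measurable_complexParts {Ω : Type*} [MeasurableSpace Ω] {v : Ω → ℂ} (hv : Measurable v)
    (i : Fin 4) : Measurable (complexParts v i) := by
  fin_cases i <;> simp only [complexParts] <;> simp <;> fun_prop

theorem integrable_complexParts {Ω : Type*} [MeasurableSpace Ω] {μ : Measure Ω} {v : Ω → ℂ}
    (hv : Integrable v μ) (i : Fin 4) : Integrable (complexParts v i) μ := by
  fin_cases i
  · exact hv.re
  · exact hv.re.neg
  · exact hv.im
  · exact hv.im.neg

/-- `ENNReal.ofReal` cuts the functions `±Re v`, `±Im v` down to their positive parts, and `v` is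
the combination of these with coefficients `1, -1, i, -i`. -/
theorem integral_smul_eq_sum_complexParts {Ω : Type*} [MeasurableSpace Ω] (μ : Measure Ω)
    {v : Ω → ℂ} (hvm : Measurable v) (hv : Integrable v μ) {φ : Ω → ℝ≥0} (hφ : Measurable φ)
    {F : ℝ≥0 → E} (hF : Continuous F) {C : ℝ} (hC : ∀ s, ‖F s‖ ≤ C) :
    ∫ y, v y • F (φ y) ∂μ = ∑ i, (![1, -1, Complex.I, -Complex.I] : Fin 4 → ℂ) i •
      ∫ s, F s ∂((μ.withDensity fun y => ENNReal.ofReal (complexParts v i y)).map φ) := by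
  have h1 : ∀ i, ∫ s, F s ∂((μ.withDensity fun y => ENNReal.ofReal (complexParts v i y)).map φ)
      = ∫ y, max (complexParts v i y) 0 • F (φ y) ∂μ := by
    intro i
    rw [integral_map hφ.aemeasurable hF.aestronglyMeasurable,
      integral_withDensity_eq_integral_toReal_smul
        (by have := measurable_complexParts hvm i; fun_prop) (by simp)]
    simp only [ENNReal.toReal_ofReal']
  have h2 : ∀ i, Integrable (fun y => max (complexParts v i y) 0 • F (φ y)) μ := by
    intro i
    refine Integrable.smul_bdd (𝕜 := ℝ) (β := E) (integrable_complexParts hv i).pos_part C ?_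
      (Eventually.of_forall fun y => hC _)
    exact (hF.stronglyMeasurable.comp_measurable hφ).aestronglyMeasurable
  simp only [h1, Fin.sum_univ_four]
  simp only [← integral_smul]
  rw [← integral_add, ← integral_add, ← integral_add]
  rotate_left
  · exact (((h2 0).smul (1 : ℂ)).add ((h2 1).smul (-1 : ℂ))).add ((h2 2).smul Complex.I)
  · exact (h2 3).smul (-Complex.I)
  · exact ((h2 0).smul (1 : ℂ)).add ((h2 1).smul (-1 : ℂ))
  · exact (h2 2).smul Complex.I
  · exact (h2 0).smul (1 : ℂ)
  · exact (h2 1).smul (-1 : ℂ)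
  refine integral_congr_ae (Eventually.of_forall fun y => ?_)
  have h3 : v y = ((max (v y).re 0 : ℝ) : ℂ) - ((max (-(v y).re) 0 : ℝ) : ℂ)
      + Complex.I * ((max (v y).im 0 : ℝ) : ℂ) - Complex.I * ((max (-(v y).im) 0 : ℝ) : ℂ) := by
    rw [add_sub_assoc, ← mul_sub, ← Complex.ofReal_sub, ← Complex.ofReal_sub,
      max_zero_sub_eq_self, max_zero_sub_eq_self, mul_comm, Complex.re_add_im]
  simp only
  conv_lhs => rw [h3]
  simp only [complexParts, Matrix.cons_val, sub_smul, add_smul, mul_smul, Complex.coe_smul,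
    one_smul, neg_smul]
  abel

/-- The integral against a complex density, pushed forward to `[0, ∞)`, is a combination of
integrals against four finite measures. -/
theorem exists_measures_of_density {Ω : Type*} [MeasurableSpace Ω] (μ : Measure Ω) {w : Ω → ℂ}
    (hw : Integrable w μ) {φ : Ω → ℝ≥0} (hφ : Measurable φ) (E : Type*) [NormedAddCommGroup E]
    [NormedSpace ℂ E] :
    ∃ (c : Fin 4 → ℂ) (m : Fin 4 → Measure ℝ≥0), (∀ i, IsFiniteMeasure (m i)) ∧
      (∀ (F : ℝ≥0 → ℂ) (_ : Continuous F) (C : ℝ) (_ : ∀ s, ‖F s‖ ≤ C),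
        ∫ y, w y • F (φ y) ∂μ = ∑ i, c i • ∫ s, F s ∂(m i)) ∧
      ∀ (F : ℝ≥0 → E) (_ : Continuous F) (C : ℝ) (_ : ∀ s, ‖F s‖ ≤ C),
        ∫ y, w y • F (φ y) ∂μ = ∑ i, c i • ∫ s, F s ∂(m i) := by
  set v : Ω → ℂ := hw.1.mk w
  have hvw : w =ᵐ[μ] v := hw.1.ae_eq_mk
  have hvm : Measurable v := hw.1.stronglyMeasurable_mk.measurable
  have hvi : Integrable v μ := hw.congr hvw
  refine ⟨![1, -1, Complex.I, -Complex.I],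
    fun i => (μ.withDensity fun y => ENNReal.ofReal (complexParts v i y)).map φ, fun i => ?_,
    fun F hF C hC => ?_, fun F hF C hC => ?_⟩
  · have := isFiniteMeasure_withDensity_ofReal (integrable_complexParts hvi i).2
    exact Measure.isFiniteMeasure_map _ _
  all_goals
    rw [← integral_smul_eq_sum_complexParts μ hvm hvi hφ hF hC]
    refine integral_congr_ae ?_
    filter_upwards [hvw] with y hy
    rw [hy]

/-- Every `m i` is absolutely continuous with respect to the sum of all of them, so that sum serves
as a common reference measure. -/
theorem integral_sum_rnDeriv_smul {ι : Type*} [Fintype ι] (c : ι → ℂ) (m : ι → Measure ℝ≥0)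
    [∀ i, IsFiniteMeasure (m i)] {F : ℝ≥0 → E} (hF : Continuous F) {C : ℝ}
    (hC : ∀ s, ‖F s‖ ≤ C) :
    ∫ s, (∑ i, c i * (((m i).rnDeriv (∑ i, m i) s).toReal : ℂ)) • F s ∂(∑ i, m i) =
      ∑ i, c i • ∫ s, F s ∂(m i) := by
  have hac : ∀ i, m i ≪ ∑ i, m i := by
    intro i s hs
    rw [Measure.coe_finsetSum, Finset.sum_apply, Finset.sum_eq_zero_iff] at hs
    exact hs i (Finset.mem_univ i)
  simp only [Finset.sum_smul]
  rw [integral_finsetSum]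
  · refine Finset.sum_congr rfl fun i _ => ?_
    simp only [mul_smul, integral_smul, Complex.coe_smul]
    rw [integral_rnDeriv_smul (hac i)]
  · intro i _
    exact Integrable.smul_bdd ((Measure.integrable_toReal_rnDeriv).ofReal.const_mul _) C
      hF.aestronglyMeasurable (Eventually.of_forall hC)

/-- A complex combination of finite measures has a density with respect to a finite measure. -/
theorem exists_density_of_measures {ι : Type*} [Fintype ι] (c : ι → ℂ) (m : ι → Measure ℝ≥0)
    [∀ i, IsFiniteMeasure (m i)] (E : Type*) [NormedAddCommGroup E] [NormedSpace ℂ E] :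
    ∃ (μ : Measure ℝ≥0) (w : ℝ≥0 → ℂ), IsFiniteMeasure μ ∧ Integrable w μ ∧
      (∀ (F : ℝ≥0 → ℂ) (_ : Continuous F) (C : ℝ) (_ : ∀ s, ‖F s‖ ≤ C),
        ∫ s, w s • F s ∂μ = ∑ i, c i • ∫ s, F s ∂(m i)) ∧
      ∀ (F : ℝ≥0 → E) (_ : Continuous F) (C : ℝ) (_ : ∀ s, ‖F s‖ ≤ C),
        ∫ s, w s • F s ∂μ = ∑ i, c i • ∫ s, F s ∂(m i) :=
  ⟨∑ i, m i, fun s => ∑ i, c i * (((m i).rnDeriv (∑ i, m i) s).toReal : ℂ), inferInstance,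
    integrable_finsetSum _ fun _ _ => (Measure.integrable_toReal_rnDeriv).ofReal.const_mul _,
    fun _ hF _ hC => integral_sum_rnDeriv_smul c m hF hC,
    fun _ hF _ hC => integral_sum_rnDeriv_smul c m hF hC⟩

end LaplaceUniqueness

/-! ### The Hille-Phillips calculus as an algebra homomorphism -/

section HillePhillipsAlgebra

variable {X : Type*} [NormedAddCommGroup X] [NormedSpace ℂ X]

theorem C0Semigroup.IsBounded.exists_bound {T : C0Semigroup X} (hT : T.IsBounded) :
    ∃ M : ℝ, 0 < M ∧ ∀ (s : ℝ≥0) (x : X), ‖T.op s x‖ ≤ M * ‖x‖ := by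
  obtain ⟨M, hM⟩ := hT
  refine ⟨max M 1, by positivity, fun s x => ?_⟩
  exact ((T.op s).le_opNorm x).trans
    (mul_le_mul_of_nonneg_right ((hM s).trans (le_max_left _ _)) (norm_nonneg x))

/-- `f` is the Laplace transform of a complex combination of finite measures, and `S` is the
corresponding combination of integrals of the semigroup. -/
def HasHPRep (T : C0Semigroup X) (f : ℂ → ℂ) (S : X →L[ℂ] X) : Prop :=
  ∃ (ι : Type) (_ : Fintype ι) (c : ι → ℂ) (m : ι → Measure ℝ≥0), (∀ i, IsFiniteMeasure (m i)) ∧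
    (∀ z : ℂ, 0 < z.re → f z = ∑ i, c i * ∫ s : ℝ≥0, Complex.exp (-(z * ((s : ℝ) : ℂ))) ∂(m i)) ∧
    ∀ x : X, S x = ∑ i, c i • ∫ s, T.op s x ∂(m i)

variable {T : C0Semigroup X}

namespace HasHPRep

theorem congr {f f' : ℂ → ℂ} {S : X →L[ℂ] X} (h : HasHPRep T f S)
    (hff' : ∀ z : ℂ, 0 < z.re → f' z = f z) : HasHPRep T f' S := by
  obtain ⟨ι, _, c, m, hm, hf, hS⟩ := h
  exact ⟨ι, inferInstance, c, m, hm, fun z hz => by rw [hff' z hz, hf z hz], hS⟩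

theorem smul {f : ℂ → ℂ} {S : X →L[ℂ] X} (a : ℂ) (h : HasHPRep T f S) :
    HasHPRep T (fun z => a * f z) (a • S) := by
  obtain ⟨ι, _, c, m, hm, hf, hS⟩ := h
  refine ⟨ι, inferInstance, fun i => a * c i, m, hm, fun z hz => ?_, fun x => ?_⟩
  · beta_reduce
    rw [hf z hz, Finset.mul_sum]
    simp only [mul_assoc]
  · simp only [smul_apply, hS, Finset.smul_sum, mul_smul]

theorem add {f g : ℂ → ℂ} {S R : X →L[ℂ] X} (h : HasHPRep T f S) (h' : HasHPRep T g R) :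
    HasHPRep T (fun z => f z + g z) (S + R) := by
  obtain ⟨ι, _, c, m, hm, hf, hS⟩ := h
  obtain ⟨κ, _, d, n, hn, hg, hR⟩ := h'
  refine ⟨ι ⊕ κ, inferInstance, Sum.elim c d, Sum.elim m n, ?_, fun z hz => ?_, fun x => ?_⟩
  · rintro (i | i)
    · exact hm i
    · exact hn i
  · beta_reduce
    rw [hf z hz, hg z hz, Fintype.sum_sum_type]
    rfl
  · rw [add_apply, hS, hR, Fintype.sum_sum_type]
    rfl

theorem sub {f g : ℂ → ℂ} {S R : X →L[ℂ] X} (h : HasHPRep T f S) (h' : HasHPRep T g R) :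
    HasHPRep T (fun z => f z - g z) (S - R) := by
  have := h.add (h'.smul (-1))
  rw [neg_one_smul, ← sub_eq_add_neg] at this
  exact this.congr fun z _ => by ring

theorem eq_zero (hT : T.IsBounded) {f : ℂ → ℂ} {S : X →L[ℂ] X} (h : HasHPRep T f S)
    (hf0 : ∀ z : ℂ, 0 < z.re → f z = 0) : S = 0 := by
  obtain ⟨ι, _, c, m, hm, hf, hS⟩ := h
  obtain ⟨M, -, hM⟩ := hT.exists_bound
  ext x
  rw [hS, zero_apply]
  exact sum_smul_integral_eq_zero c m (fun z hz => by rw [← hf z hz, hf0 z hz])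
    (T.continuous_op x) (fun s => hM s x)

/-- This is the workhorse: an algebraic identity between symbols on the right half-plane becomes an
identity between operators. -/
theorem unique (hT : T.IsBounded) {f : ℂ → ℂ} {S R : X →L[ℂ] X} (h : HasHPRep T f S)
    (h' : HasHPRep T f R) : S = R :=
  sub_eq_zero.1 ((h.sub h').eq_zero hT fun _ _ => sub_self _)

/-- With an arbitrary parameter space `Ω` and times `φ`, Lebesgue densities on half-lines and the
two-parameter integral of the Taylor remainder enter the calculus without computing any
push-forward. -/
theorem of_density (hT : T.IsBounded) {Ω : Type*} [MeasurableSpace Ω] (μ : Measure Ω) {w : Ω → ℂ}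
    (hw : Integrable w μ) {φ : Ω → ℝ≥0} (hφ : Measurable φ) {S : X →L[ℂ] X}
    (hS : ∀ x, S x = ∫ y, w y • T.op (φ y) x ∂μ) :
    HasHPRep T (fun z => ∫ y, Complex.exp (-(z * ((φ y : ℝ) : ℂ))) * w y ∂μ) S := by
  obtain ⟨M, -, hM⟩ := hT.exists_bound
  obtain ⟨c, m, hm, h1, h2⟩ := exists_measures_of_density μ hw hφ X
  refine ⟨Fin 4, inferInstance, c, m, hm, fun z hz => ?_, fun x => ?_⟩
  · have := h1 _ (continuous_cexp_neg_mul z) 1 (norm_cexp_neg_mul_le hz.le)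
    simp only [smul_eq_mul] at this
    rw [← this]
    simp only [mul_comm]
  · rw [hS, h2 _ (T.continuous_op x) _ (fun s => hM s x)]

theorem exists_isLaplaceTransformOn (hT : T.IsBounded) {f : ℂ → ℂ} {S : X →L[ℂ] X}
    (h : HasHPRep T f S) : ∃ (μ : Measure ℝ≥0) (w : ℝ≥0 → ℂ), IsLaplaceTransformOn f μ w ∧
      ∀ x : X, S x = ∫ s : ℝ≥0, w s • T.op s x ∂μ := by
  obtain ⟨ι, _, c, m, hm, hf, hS⟩ := h
  obtain ⟨M, -, hM⟩ := hT.exists_bound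
  obtain ⟨μ, w, hμ, hw, h1, h2⟩ := exists_density_of_measures c m X
  refine ⟨μ, w, ⟨hμ, hw, fun z hz => ?_⟩, fun x => ?_⟩
  · rw [hf z hz]
    have := h1 _ (continuous_cexp_neg_mul z) 1 (norm_cexp_neg_mul_le hz.le)
    simp only [smul_eq_mul] at this
    rw [← this]
    simp only [mul_comm]
  · rw [hS, h2 _ (T.continuous_op x) _ (fun s => hM s x)]

theorem mem_HPAlgebra (hT : T.IsBounded) {f : ℂ → ℂ} {S : X →L[ℂ] X}
    (h : HasHPRep T f S) : f ∈ HPAlgebra := by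
  obtain ⟨μ, w, h1, -⟩ := h.exists_isLaplaceTransformOn hT
  exact ⟨μ, w, h1⟩

theorem hpOp_eq (hT : T.IsBounded) {f : ℂ → ℂ} {S : X →L[ℂ] X} (h : HasHPRep T f S) :
    hpOp T f = S := by
  have hex : ∃ S : X →L[ℂ] X, ∃ (μ : Measure ℝ≥0) (w : ℝ≥0 → ℂ), IsLaplaceTransformOn f μ w ∧
      ∀ x : X, S x = ∫ s : ℝ≥0, w s • T.op s x ∂μ :=
    ⟨S, h.exists_isLaplaceTransformOn hT⟩
  obtain ⟨μ, w, ⟨-, hw, hf⟩, hS⟩ := hex.choose_spec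
  rw [hpOp, dif_pos hex]
  exact ((of_density hT μ hw measurable_id hS).congr hf).unique hT h

theorem exists_of_density (hT : T.IsBounded) {Ω : Type*} [MeasurableSpace Ω] (μ : Measure Ω)
    {w : Ω → ℂ} (hw : Integrable w μ) {φ : Ω → ℝ≥0} (hφ : Measurable φ) :
    ∃ S : X →L[ℂ] X,
      HasHPRep T (fun z => ∫ y, Complex.exp (-(z * ((φ y : ℝ) : ℂ))) * w y ∂μ) S ∧
      ∀ x, S x = ∫ y, w y • T.op (φ y) x ∂μ := by
  obtain ⟨M, -, hM⟩ := hT.exists_bound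
  have hint : ∀ x, Integrable (fun y => w y • T.op (φ y) x) μ := fun x =>
    Integrable.smul_bdd hw (M * ‖x‖)
      ((T.continuous_op x).stronglyMeasurable.comp_measurable hφ).aestronglyMeasurable
      (Eventually.of_forall fun y => hM _ x)
  let S : X →ₗ[ℂ] X :=
    { toFun := fun x => ∫ y, w y • T.op (φ y) x ∂μ
      map_add' := fun x x' => by
        simp only [map_add, smul_add]
        exact integral_add (hint x) (hint x')
      map_smul' := fun a x => by
        simp only [map_smul, RingHom.id_apply, smul_comm _ a]
        exact integral_smul _ _ }
  let S' : X →L[ℂ] X := S.mkContinuous ((∫ y, ‖w y‖ ∂μ) * M) (fun x => by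
    calc ‖∫ y, w y • T.op (φ y) x ∂μ‖ ≤ ∫ y, ‖w y‖ * (M * ‖x‖) ∂μ := by
          refine norm_integral_le_of_norm_le (hw.norm.mul_const _) (Eventually.of_forall fun y => ?_)
          rw [norm_smul]
          exact mul_le_mul_of_nonneg_left (hM _ x) (norm_nonneg _)
      _ = (∫ y, ‖w y‖ ∂μ) * M * ‖x‖ := by rw [integral_mul_const, mul_assoc])
  exact ⟨S', of_density hT μ hw hφ fun x => rfl, fun x => rfl⟩

variable [CompleteSpace X]

theorem op (t : ℝ≥0) :
    HasHPRep T (fun z => Complex.exp (-(z * ((t : ℝ) : ℂ)))) (T.op t) :=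
  ⟨Unit, inferInstance, fun _ => 1, fun _ => Measure.dirac t, fun _ => inferInstance,
    fun z _ => by simp, fun x => by simp⟩

theorem one : HasHPRep T (fun _ => 1) 1 := by
  have := op (T := T) 0
  rw [T.op_zero] at this
  exact this.congr fun z _ => by simp

/-- Convolution of measures multiplies the Laplace transforms and, by the semigroup law and Fubini,
the operators. -/
theorem mul (hT : T.IsBounded) {f g : ℂ → ℂ} {S R : X →L[ℂ] X} (h : HasHPRep T f S)
    (h' : HasHPRep T g R) : HasHPRep T (fun z => f z * g z) (S * R) := by
  obtain ⟨ι, _, c, m, hm, hf, hS⟩ := h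
  obtain ⟨κ, _, d, n, hn, hg, hR⟩ := h'
  obtain ⟨M, -, hM⟩ := hT.exists_bound
  refine ⟨ι × κ, inferInstance, fun p => c p.1 * d p.2, fun p => m p.1 ∗ n p.2, ?_,
    fun z hz => ?_, fun x => ?_⟩
  · intro p
    have := hm p.1
    have := hn p.2
    infer_instance
  · beta_reduce
    rw [hf z hz, hg z hz, Finset.sum_mul_sum, Fintype.sum_prod_type]
    refine Finset.sum_congr rfl fun i _ => Finset.sum_congr rfl fun j _ => ?_
    have := hm i
    have := hn j
    rw [integral_conv ((continuous_cexp_neg_mul z).integrable_of_norm_le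
      (norm_cexp_neg_mul_le hz.le) _)]
    simp only [NNReal.coe_add, Complex.ofReal_add, mul_add, neg_add, Complex.exp_add,
      integral_const_mul, integral_mul_const]
    ring
  · beta_reduce
    rw [mul_apply_eq_comp, hS, Fintype.sum_prod_type]
    refine Finset.sum_congr rfl fun i _ => ?_
    have := hm i
    have hint : ∀ j, Integrable (fun s => T.op s x) (n j) := fun j => by
      have := hn j
      exact (T.continuous_op x).integrable_of_norm_le (fun s => hM s x) _
    have h1 : ∀ s, T.op s (R x) = ∑ j, d j • ∫ u, T.op (s + u) x ∂(n j) := by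
      intro s
      simp only [hR, map_sum, map_smul, T.op_add, ContinuousLinearMap.comp_apply]
      refine Finset.sum_congr rfl fun j _ => ?_
      rw [ContinuousLinearMap.integral_comp_comm _ (hint j)]
    have hconv : ∀ j, Integrable (fun s => T.op s x) (m i ∗ n j) := fun j => by
      have := hn j
      exact (T.continuous_op x).integrable_of_norm_le (fun s => hM s x) _
    have h2 : ∀ j, Integrable (fun s => ∫ u, T.op (s + u) x ∂(n j)) (m i) := fun j => by
      have := hn j
      have := (hconv j)
      rw [Measure.conv, integrable_map_measure (T.continuous_op x).aestronglyMeasurable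
        (by fun_prop)] at this
      exact this.integral_prod_left
    simp only [h1]
    rw [integral_finsetSum, Finset.smul_sum]
    swap
    · exact fun j _ => (h2 j).smul (d j)
    refine Finset.sum_congr rfl fun j _ => ?_
    have := hn j
    rw [integral_smul, mul_smul, integral_conv (hconv j)]

theorem pow (hT : T.IsBounded) {f : ℂ → ℂ} {S : X →L[ℂ] X} (h : HasHPRep T f S) (n : ℕ) :
    HasHPRep T (fun z => f z ^ n) (S ^ n) := by
  induction n with
  | zero => simpa using one
  | succ n ih => simpa only [pow_succ] using ih.mul hT h

end HasHPRep

theorem hasHPRep_hpOp (hT : T.IsBounded) {f : ℂ → ℂ} (hf : f ∈ HPAlgebra) :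
    HasHPRep T f (hpOp T f) := by
  obtain ⟨μ, w, -, hw, hf⟩ := hf
  obtain ⟨S, hS, -⟩ := HasHPRep.exists_of_density (T := T) hT μ hw (φ := id) measurable_id
  have hS' : HasHPRep T f S := hS.congr hf
  rwa [hS'.hpOp_eq hT]

variable [CompleteSpace X]

/-- If `f` has a regularizer and `f d` is in the Hille-Phillips algebra, then `f(A) d(A)` is
everywhere defined and equal to `(f d)(A)`. -/
theorem compEqBounded_extHPOp (hT : T.IsBounded) {f d : ℂ → ℂ} (hreg : ∃ e, IsRegularizer T f e)
    {D S : X →L[ℂ] X} (hD : HasHPRep T d D) (hS : HasHPRep T (fun z => f z * d z) S) :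
    CompEqBounded (extHPOp T f) D S := by
  intro x
  have he := hreg.choose_spec
  set e := hreg.choose with he_def
  have h1 : (D x, S x) ∈ (extHPOp T f).graph := by
    -- Whichever regularizer `e` was chosen, membership in the graph reads `(e f)(A) D x = e(A) S
    -- x`. Both sides have symbol `e f d`.
    rw [extHPOp, dif_pos hreg, mem_regularizedOp_graph he]
    have h2 := (hasHPRep_hpOp hT he.2.2.1).mul hT hD
    have h3 := (hasHPRep_hpOp hT he.2.1).mul hT hS
    have h4 := h2.unique hT (h3.congr fun z _ => by ring)
    exact congrArg (fun U : X →L[ℂ] X => U x) h4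
  rw [LinearPMap.mem_graph_iff] at h1
  obtain ⟨y, hy1, hy2⟩ := h1
  have hmem : D x ∈ (extHPOp T f).domain := by
    simp only at hy1
    rw [← hy1]
    exact y.2
  refine ⟨hmem, ?_⟩
  simp only at hy1 hy2
  rw [← hy2]
  congr 1
  exact Subtype.ext hy1.symm

end HillePhillipsAlgebra

/-! ### Semigroups, resolvents and the approximate point spectrum -/

section Semigroup

variable {X : Type*} [NormedAddCommGroup X] [NormedSpace ℂ X]

theorem C0Semigroup.continuous_op_toNNReal (T : C0Semigroup X) (x : X) :
    Continuous fun s : ℝ => T.op s.toNNReal x :=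
  (T.continuous_op x).comp continuous_real_toNNReal

theorem tendsto_toNNReal_sub_nhdsGT (s : ℝ) :
    Tendsto (fun u : ℝ => (u - s).toNNReal) (𝓝[>] s) (𝓝[>] 0) := by
  refine tendsto_nhdsWithin_iff.2 ⟨?_, ?_⟩
  · have : Tendsto (fun u : ℝ => (u - s).toNNReal) (𝓝 s) (𝓝 ((s - s).toNNReal)) :=
      Continuous.tendsto (by fun_prop) s
    rw [sub_self, Real.toNNReal_zero] at this
    exact this.mono_left nhdsWithin_le_nhds
  · filter_upwards [self_mem_nhdsWithin] with u hu
    simpa using hu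

theorem hasDerivWithinAt_op {T : C0Semigroup X} {x y : X} (h : (x, y) ∈ T.generatorGraph)
    {s : ℝ} (hs : 0 ≤ s) :
    HasDerivWithinAt (fun s : ℝ => T.op s.toNNReal x) (T.op s.toNNReal y) (Ioi s) s := by
  rw [hasDerivWithinAt_iff_tendsto_slope' (by simp)]
  have h1 : Tendsto (fun h : ℝ≥0 => ((h : ℝ)⁻¹ : ℂ) • (T.op h x - x)) (𝓝[>] 0) (𝓝 y) := h
  have h2 := ((T.op s.toNNReal).continuous.tendsto y).comp (h1.comp (tendsto_toNNReal_sub_nhdsGT s))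
  refine h2.congr' ?_
  filter_upwards [self_mem_nhdsWithin] with u hu
  have hu' : 0 ≤ u - s := sub_nonneg.2 (le_of_lt hu)
  have hadd : T.op u.toNNReal = (T.op s.toNNReal).comp (T.op (u - s).toNNReal) := by
    rw [← T.op_add, ← Real.toNNReal_add hs hu', add_sub_cancel]
  simp only [Function.comp_apply, map_smul, map_sub, slope, vsub_eq_sub, hadd,
    ContinuousLinearMap.comp_apply, Real.coe_toNNReal _ hu']
  rw [← Complex.ofReal_inv, Complex.coe_smul]

variable [CompleteSpace X]

/-- Variation of constants for the semigroup `e^{λt} T(t)`. -/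
theorem integral_cexp_smul_op {T : C0Semigroup X} {x y : X} (h : (x, y) ∈ T.generatorGraph) (l : ℂ)
    (t : ℝ≥0) :
    ∫ s in (0 : ℝ)..t, Complex.exp (l * s) • T.op s.toNNReal (y + l • x) =
      Complex.exp (l * (t : ℝ)) • T.op t x - x := by
  have hc : ∀ v : X, Continuous fun s : ℝ => Complex.exp (l * s) • T.op s.toNNReal v := fun v =>
    Continuous.smul (by fun_prop) (T.continuous_op_toNNReal v)
  have := intervalIntegral.integral_eq_sub_of_hasDeriv_right_of_le (a := 0) (b := (t : ℝ))
    (f := fun s : ℝ => Complex.exp (l * s) • T.op s.toNNReal x)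
    (f' := fun s : ℝ => Complex.exp (l * s) • T.op s.toNNReal (y + l • x)) t.2
    (hc x).continuousOn (fun s hs => ?_) ((hc _).intervalIntegrable _ _)
  · rw [this]
    simp [T.op_zero]
  · have h1 : HasDerivAt (fun s : ℝ => Complex.exp (l * s)) (Complex.exp (l * s) * l) s := by
      have : HasDerivAt (fun s : ℝ => l * (s : ℂ)) (l * 1) s :=
        (Complex.ofRealCLM.hasDerivAt (x := s)).const_mul l
      simpa using this.cexp
    have h2 := h1.hasDerivWithinAt.smul (hasDerivWithinAt_op h hs.1.le)
    have h3 : Complex.exp (l * s) • T.op s.toNNReal (y + l • x) =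
        Complex.exp (l * s) • T.op s.toNNReal y +
          (Complex.exp (l * s) * l) • T.op s.toNNReal x := by
      rw [map_add, map_smul, smul_add, smul_smul]
    simp only [h3]
    exact h2

/-- The factor `e^{irs}` is unimodular and turns the orbit into one with velocity `e^{irs} T(s)(y +
irx)`. An approximate eigenvector thus nearly follows `e^{-irt} x`, with an error linear in `t`. -/
theorem norm_cexp_smul_op_sub_le {T : C0Semigroup X} {M : ℝ}
    (hM : ∀ (s : ℝ≥0) (x : X), ‖T.op s x‖ ≤ M * ‖x‖) {x y : X}
    (h : (x, y) ∈ T.generatorGraph) (r : ℝ) (t : ℝ≥0) :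
    ‖T.op t x - Complex.exp (-(Complex.I * r * (t : ℝ))) • x‖ ≤ M * ‖y + (Complex.I * r) • x‖ * t := by
  have hnorm : ∀ s : ℝ, ‖Complex.exp (Complex.I * r * s)‖ = 1 := by
    intro s
    rw [Complex.norm_exp]
    simp
  have h1 : ‖Complex.exp (Complex.I * r * (t : ℝ)) • T.op t x - x‖ ≤
      M * ‖y + (Complex.I * r) • x‖ * |(t : ℝ) - 0| := by
    rw [← integral_cexp_smul_op h]
    refine intervalIntegral.norm_integral_le_of_norm_le_const fun s _ => ?_
    rw [norm_smul, hnorm, one_mul]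
    exact hM _ _
  rw [sub_zero, abs_of_nonneg t.coe_nonneg] at h1
  have h2 : T.op t x - Complex.exp (-(Complex.I * r * (t : ℝ))) • x =
      Complex.exp (-(Complex.I * r * (t : ℝ))) •
        (Complex.exp (Complex.I * r * (t : ℝ)) • T.op t x - x) := by
    rw [smul_sub, smul_smul, ← Complex.exp_add, neg_add_cancel, Complex.exp_zero, one_smul]
  rw [h2, norm_smul, Complex.exp_neg, norm_inv, hnorm, inv_one, one_mul]
  exact h1

omit [CompleteSpace X] in
/-- The truncated integral of the semigroup. -/
theorem exists_hasHPRep_integral {T : C0Semigroup X} (hT : T.IsBounded) (t : ℝ≥0) :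
    ∃ V : X →L[ℂ] X,
      HasHPRep T (fun z => (1 - Complex.exp (-(z * ((t : ℝ) : ℂ)))) / z) V ∧
      ∀ x, V x = ∫ s in (0 : ℝ)..t, T.op s.toNNReal x := by
  obtain ⟨V, hV, hVx⟩ := HasHPRep.exists_of_density (T := T) hT (volume.restrict (Ioc (0 : ℝ) t))
    (w := fun _ => 1) (integrable_const _) (φ := Real.toNNReal) measurable_real_toNNReal
  refine ⟨V, hV.congr fun z hz => ?_, fun x => ?_⟩
  · have hz0 : z ≠ 0 := by rintro rfl; simp at hz
    have h1 : ∫ y in Ioc (0 : ℝ) t, Complex.exp (-(z * ((y.toNNReal : ℝ) : ℂ))) * 1 =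
        ∫ y in (0 : ℝ)..t, Complex.exp ((-z) * y) := by
      rw [intervalIntegral.integral_of_le t.coe_nonneg]
      refine setIntegral_congr_fun measurableSet_Ioc fun y hy => ?_
      simp only [Real.coe_toNNReal y hy.1.le, mul_one, neg_mul]
    rw [h1, integral_exp_mul_complex (neg_ne_zero.2 hz0)]
    simp only [Complex.ofReal_zero, mul_zero, Complex.exp_zero]
    rw [div_neg, ← neg_div, neg_sub, neg_mul]
  · rw [hVx, intervalIntegral.integral_of_le t.coe_nonneg]
    simp

omit [CompleteSpace X] in
/-- The resolvent of the generator in the right half-plane. -/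
theorem exists_hasHPRep_resolvent {T : C0Semigroup X} (hT : T.IsBounded) {l : ℂ} (hl : 0 < l.re) :
    ∃ R : X →L[ℂ] X, HasHPRep T (fun z => (l + z)⁻¹) R := by
  have hint : IntegrableOn (fun s : ℝ => Complex.exp ((-l) * s)) (Ioi 0) :=
    integrableOn_exp_mul_complex_Ioi (by simpa using hl) 0
  obtain ⟨R, hR, -⟩ := HasHPRep.exists_of_density (T := T) hT (volume.restrict (Ioi (0 : ℝ)))
    (w := fun s => Complex.exp ((-l) * s)) hint (φ := Real.toNNReal) measurable_real_toNNReal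
  refine ⟨R, hR.congr fun z hz => ?_⟩
  have hre : (-(l + z)).re < 0 := by
    simp only [Complex.neg_re, Complex.add_re]; linarith
  have h1 : ∫ y in Ioi (0 : ℝ), Complex.exp (-(z * ((y.toNNReal : ℝ) : ℂ))) * Complex.exp ((-l) * y) =
        ∫ y in Ioi (0 : ℝ), Complex.exp ((-(l + z)) * y) := by
    refine setIntegral_congr_fun measurableSet_Ioi fun y hy => ?_
    simp only [Real.coe_toNNReal y (le_of_lt hy), ← Complex.exp_add]
    ring_nf
  rw [h1, integral_exp_mul_complex_Ioi hre]
  simp only [Complex.ofReal_zero, mul_zero, Complex.exp_zero]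
  rw [neg_div_neg_eq, one_div]

theorem tendsto_inv_smul_integral_op (T : C0Semigroup X) (x : X) :
    Tendsto (fun h : ℝ≥0 => ((h : ℝ)⁻¹ : ℂ) • ∫ s in (0 : ℝ)..h, T.op s.toNNReal x)
      (𝓝[>] 0) (𝓝 x) := by
  have hc := T.continuous_op_toNNReal x
  have h1 : HasDerivAt (fun u : ℝ => ∫ s in (0 : ℝ)..u, T.op s.toNNReal x)
      (T.op (0 : ℝ).toNNReal x) 0 :=
    intervalIntegral.integral_hasDerivAt_right (hc.intervalIntegrable _ _)
      (hc.stronglyMeasurableAtFilter _ _) hc.continuousAt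
  rw [hasDerivAt_iff_tendsto_slope_zero] at h1
  simp only [Real.toNNReal_zero, T.op_zero, ContinuousLinearMap.id_apply, zero_add,
    intervalIntegral.integral_same, sub_zero] at h1
  have h2 : Tendsto (fun h : ℝ≥0 => (h : ℝ)) (𝓝[>] 0) (𝓝[≠] 0) := by
    refine tendsto_nhdsWithin_iff.2 ⟨?_, ?_⟩
    · exact (NNReal.continuous_coe.tendsto' 0 0 NNReal.coe_zero).mono_left nhdsWithin_le_nhds
    · filter_upwards [self_mem_nhdsWithin] with h hh
      have : (0 : ℝ≥0) < h := hh
      simpa using this.ne'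
  refine (h1.comp h2).congr fun h => ?_
  simp only [Function.comp_apply]
  rw [← Complex.ofReal_inv, Complex.coe_smul]

theorem resolvent_identities {T : C0Semigroup X} (hT : T.IsBounded) {l : ℂ} (hl : 0 < l.re)
    {R : X →L[ℂ] X} (hR : HasHPRep T (fun z => (l + z)⁻¹) R) :
    (∀ x, (R x, l • R x - x) ∈ T.generatorGraph) ∧
      ∀ x y, (x, y) ∈ T.generatorGraph → R (l • x - y) = x := by
  -- In symbols: `(e^{-hz} - 1) / (l + z) = (l / (l + z) - 1) (1 - e^{-hz}) / z`. Dividing by `h`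
  -- and letting `h → 0` yields the generator on the range of `R`.
  have hid : ∀ (h : ℝ≥0) (x : X), T.op h (R x) - R x =
      l • R (∫ s in (0 : ℝ)..h, T.op s.toNNReal x) - ∫ s in (0 : ℝ)..h, T.op s.toNNReal x := by
    intro h x
    obtain ⟨V, hV, hVx⟩ := exists_hasHPRep_integral hT h
    have h1 := ((HasHPRep.op (T := T) h).sub HasHPRep.one).mul hT hR
    have h2 := ((hR.smul l).sub HasHPRep.one).mul hT hV
    have h3 := h1.unique hT (h2.congr fun z hz => by
      have hz0 : z ≠ 0 := by rintro rfl; simp at hz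
      have hlz : l + z ≠ 0 := by
        intro h0
        have := congrArg Complex.re h0
        simp only [Complex.add_re, Complex.zero_re] at this
        linarith
      field_simp
      ring)
    have h4 := congrArg (fun U : X →L[ℂ] X => U x) h3
    simpa [hVx] using h4
  have hcomm : ∀ (h : ℝ≥0) (x : X), T.op h (R x) = R (T.op h x) := by
    intro h x
    have h1 := ((HasHPRep.op (T := T) h).mul hT hR).unique hT
      ((hR.mul hT (HasHPRep.op (T := T) h)).congr fun z _ => mul_comm _ _)
    exact congrArg (fun U : X →L[ℂ] X => U x) h1
  have hlim : ∀ x, Tendsto (fun h : ℝ≥0 => ((h : ℝ)⁻¹ : ℂ) • (T.op h (R x) - R x))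
      (𝓝[>] 0) (𝓝 (l • R x - x)) := by
    intro x
    have h1 := tendsto_inv_smul_integral_op T x
    have h2 := (((R.continuous.tendsto x).comp h1).const_smul l).sub h1
    refine h2.congr fun h => ?_
    simp only [Function.comp_apply, hid, map_smul, smul_sub, smul_comm l]
  refine ⟨hlim, fun x y hxy => ?_⟩
  have h1 : Tendsto (fun h : ℝ≥0 => ((h : ℝ)⁻¹ : ℂ) • (T.op h x - x)) (𝓝[>] 0) (𝓝 y) := hxy
  have h2 := (R.continuous.tendsto y).comp h1
  have h3 := tendsto_nhds_unique (hlim x) (h2.congr fun h => by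
    simp only [Function.comp_apply, map_smul, map_sub, hcomm])
  rw [map_sub, map_smul, ← h3]
  abel

omit [CompleteSpace X] in
theorem mem_generatorGraph_iff {T : C0Semigroup X} {A : X →ₗ.[ℂ] X} (hA : T.generator = -A)
    (x y : X) : (x, y) ∈ T.generatorGraph ↔ ∃ h : x ∈ A.domain, A ⟨x, h⟩ = -y := by
  rw [← T.generator_graph, hA, LinearPMap.mem_graph_iff]
  constructor
  · rintro ⟨u, hu1, hu2⟩
    simp only at hu1 hu2
    subst hu1
    refine ⟨u.2, ?_⟩
    rw [← hu2, LinearPMap.neg_apply, neg_neg]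
    rfl
  · rintro ⟨h, hx⟩
    refine ⟨⟨x, h⟩, rfl, ?_⟩
    simp only
    rw [LinearPMap.neg_apply]
    exact neg_eq_iff_eq_neg.2 hx

theorem exists_resolvent {T : C0Semigroup X} (hT : T.IsBounded) {A : X →ₗ.[ℂ] X}
    (hA : T.generator = -A) {z : ℂ} (hz : z.re < 0) : ∃ R : X →L[ℂ] X,
    (∀ x : X, ∃ h : R x ∈ A.domain, z • R x - A ⟨R x, h⟩ = x) ∧
    (∀ x : A.domain, R (z • (x : X) - A x) = x) := by
  have hl : 0 < (-z).re := by simpa using hz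
  obtain ⟨R, hR⟩ := exists_hasHPRep_resolvent hT hl
  obtain ⟨h1, h2⟩ := resolvent_identities hT hl hR
  refine ⟨-R, fun x => ?_, fun x => ?_⟩
  · obtain ⟨h3, h4⟩ := (mem_generatorGraph_iff hA _ _).1 (h1 (-x))
    have he : (-R) x = R (-x) := by simp
    have h5 : (-R) x ∈ A.domain := by rw [he]; exact h3
    refine ⟨h5, ?_⟩
    have h6 : A ⟨(-R) x, h5⟩ = A ⟨R (-x), h3⟩ := by congr 1; exact Subtype.ext he
    rw [h6, h4, he]
    module
  · have h3 := h2 x (-A x) ((mem_generatorGraph_iff hA _ _).2 ⟨x.2, by simp⟩)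
    rw [neg_apply, ← map_neg, ← h3]
    congr 1
    simp only [h3]
    module

/-- A point of the spectrum on the imaginary axis is an approximate eigenvalue. -/
theorem exists_approximate_eigenvector {T : C0Semigroup X} (hT : T.IsBounded) {A : X →ₗ.[ℂ] X}
    (hA : T.generator = -A) {z : ℂ} (hz : z.re = 0) (hzs : z ∈ UnboundedOp.spectrum A)
    {ε : ℝ} (hε : 0 < ε) : ∃ x : A.domain, ‖z • (x : X) - A x‖ < ε * ‖(x : X)‖ := by
  by_contra! hcon
  apply hzs
  -- If `z - A` is bounded below by `ε`, the resolvent `B` at the nearby point `z - ε/4` has norm at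
  -- most `4 / (3ε)`. Then `‖(ε/4) B‖ ≤ 1/3`, and a Neumann series reaches `z`.
  obtain ⟨B, hB1, hB2⟩ := exists_resolvent hT hA (z := z - ((ε / 4 : ℝ) : ℂ)) (by
    rw [Complex.sub_re, Complex.ofReal_re, hz]; linarith)
  set δ : ℂ := ((ε / 4 : ℝ) : ℂ) with hδ
  have hδn : ‖δ‖ = ε / 4 := by rw [hδ, Complex.norm_real, Real.norm_of_nonneg (by positivity)]
  have hBn : ∀ x, ‖B x‖ ≤ 4 / (3 * ε) * ‖x‖ := by
    intro x
    obtain ⟨h1, h2⟩ := hB1 x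
    have h3 : z • B x - A ⟨B x, h1⟩ = x + δ • B x := by
      nth_rewrite 3 [← h2]
      module
    have h4 := hcon ⟨B x, h1⟩
    simp only [h3] at h4
    have h5 := h4.trans (norm_add_le _ _)
    rw [norm_smul, hδn] at h5
    rw [div_mul_eq_mul_div, le_div_iff₀ (by positivity)]
    linarith
  have hnorm : ‖-(δ • B)‖ < 1 := by
    rw [norm_neg, norm_smul, hδn]
    have := B.opNorm_le_bound (by positivity) hBn
    calc ε / 4 * ‖B‖ ≤ ε / 4 * (4 / (3 * ε)) := by gcongr
      _ = 1 / 3 := by field_simp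
      _ < 1 := by norm_num
  -- The factorization is `z - A = (1 + δ B)(z - δ - A)`, so the resolvent at `z` is `B U⁻¹`.
  set U := Units.oneSub (-(δ • B)) hnorm with hU
  have hUv : (U : X →L[ℂ] X) = 1 + δ • B := by rw [hU, Units.val_oneSub, sub_neg_eq_add]
  refine ⟨B * ((U⁻¹ : (X →L[ℂ] X)ˣ) : X →L[ℂ] X), fun x => ?_, fun x => ?_⟩
  · obtain ⟨h1, h2⟩ := hB1 (((U⁻¹ : (X →L[ℂ] X)ˣ) : X →L[ℂ] X) x)
    refine ⟨h1, ?_⟩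
    have h3 : (U : X →L[ℂ] X) (((U⁻¹ : (X →L[ℂ] X)ˣ) : X →L[ℂ] X) x) = x :=
      congrArg (fun V : X →L[ℂ] X => V x) U.mul_inv
    rw [hUv] at h3
    simp only [add_apply, one_apply_eq_self, smul_apply] at h3
    set u := ((U⁻¹ : (X →L[ℂ] X)ˣ) : X →L[ℂ] X) x
    change z • B u - A ⟨B u, h1⟩ = x
    have h4 : z • B u - A ⟨B u, h1⟩ = ((z - δ) • B u - A ⟨B u, h1⟩) + δ • B u := by module
    rw [h4, h2, h3]
  · set v := (z - δ) • (x : X) - A x with hv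
    have hBv : B v = x := hB2 x
    have h1 : z • (x : X) - A x = (U : X →L[ℂ] X) v := by
      rw [hUv]
      simp only [add_apply, one_apply_eq_self, smul_apply, hBv]
      rw [hv]
      module
    have h2 : ((U⁻¹ : (X →L[ℂ] X)ˣ) : X →L[ℂ] X) ((U : X →L[ℂ] X) v) = v :=
      congrArg (fun V : X →L[ℂ] X => V v) U.inv_mul
    rw [h1, mul_apply_eq_comp, h2, hBv]

/-- Spectral inclusion for the Hille-Phillips calculus on the imaginary axis. -/
theorem HasHPRep.norm_le_of_mem_spectrum {T : C0Semigroup X} (hT : T.IsBounded) {A : X →ₗ.[ℂ] X}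
    (hA : T.generator = -A) {f : ℂ → ℂ} {S : X →L[ℂ] X} (hf : HasHPRep T f S) {r : ℝ}
    (hr : Complex.I * r ∈ UnboundedOp.spectrum A) {l : ℂ}
    (hl : Tendsto (fun δ : ℝ => f (Complex.I * r + δ)) (𝓝[>] 0) (𝓝 l)) : ‖l‖ ≤ ‖S‖ := by
  obtain ⟨ι, _, c, m, hm, hfz, hS⟩ := hf
  obtain ⟨M, hM0, hM⟩ := hT.exists_bound
  have hlim : Tendsto (fun δ : ℝ => f (Complex.I * r + δ)) (𝓝[>] 0)
      (𝓝 (∑ i, c i * ∫ s : ℝ≥0, Complex.exp (-(Complex.I * r * ((s : ℝ) : ℂ))) ∂(m i))) := by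
    have h1 : Tendsto (fun δ : ℝ => ∑ i, c i *
        ∫ s : ℝ≥0, Complex.exp (-((Complex.I * r + δ) * ((s : ℝ) : ℂ))) ∂(m i)) (𝓝[>] 0)
        (𝓝 (∑ i, c i * ∫ s : ℝ≥0, Complex.exp (-(Complex.I * r * ((s : ℝ) : ℂ))) ∂(m i))) := by
      refine tendsto_finsetSum _ fun i _ => Tendsto.const_mul _ ?_
      have := hm i
      exact (continuousOn_laplace (m i) (Complex.I * r) (by simp)).tendsto.comp
        (tendsto_imaginary_add r)
    refine h1.congr' ?_
    filter_upwards [self_mem_nhdsWithin] with δ hδ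
    rw [hfz]
    simpa using hδ
  have hl' := tendsto_nhds_unique hl hlim
  have hx : ∀ k : ℕ, ∃ x : X, ‖x‖ = 1 ∧ ∃ y, (x, y) ∈ T.generatorGraph ∧
      ‖y + (Complex.I * r) • x‖ ≤ 1 / ((k : ℝ) + 1) := by
    intro k
    obtain ⟨x, hx⟩ := exists_approximate_eigenvector hT hA (by simp) hr
      (ε := 1 / ((k : ℝ) + 1)) (by positivity)
    have hx0 : 0 < ‖(x : X)‖ := by
      have := (norm_nonneg _).trans_lt hx
      exact pos_of_mul_pos_right this (by positivity)
    have hmem : ((x : X), -A x) ∈ T.generatorGraph :=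
      (mem_generatorGraph_iff hA _ _).2 ⟨x.2, by simp⟩
    refine ⟨((‖(x : X)‖ : ℂ)⁻¹) • (x : X), ?_, ((‖(x : X)‖ : ℂ)⁻¹) • (-A x),
      T.generatorGraph.smul_mem _ hmem, ?_⟩
    · rw [norm_smul, norm_inv, Complex.norm_real, norm_norm, inv_mul_cancel₀ hx0.ne']
    · rw [smul_comm, ← smul_add, norm_smul, norm_inv, Complex.norm_real, norm_norm,
        inv_mul_le_iff₀ hx0, neg_add_eq_sub, mul_comm ‖(x : X)‖]
      exact hx.le
  choose x hx1 y hy hxy using hx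
  -- The error at time `s` grows linearly in `s`, so it is not uniformly small; dominated
  -- convergence with the constant bound `M + 1` suffices.
  have hconv : Tendsto (fun k => S (x k) - l • x k) atTop (𝓝 0) := by
    have h1 : ∀ k, S (x k) - l • x k = ∑ i, c i • ∫ s : ℝ≥0, (T.op s (x k) -
        Complex.exp (-(Complex.I * r * ((s : ℝ) : ℂ))) • x k) ∂(m i) := by
      intro k
      rw [hS, hl', Finset.sum_smul, ← Finset.sum_sub_distrib]
      refine Finset.sum_congr rfl fun i _ => ?_
      have := hm i
      rw [integral_sub ((T.continuous_op _).integrable_of_norm_le (fun s => hM s _) _),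
        integral_smul_const, smul_sub, mul_smul]
      exact ((continuous_cexp_neg_mul _).integrable_of_norm_le
        (norm_cexp_neg_mul_le (by simp)) _).smul_const _
    simp only [h1]
    have h2 : (0 : X) = ∑ i, c i • ∫ _ : ℝ≥0, (0 : X) ∂(m i) := by simp
    rw [h2]
    refine tendsto_finsetSum _ fun i _ => Tendsto.const_smul ?_ _
    have := hm i
    refine tendsto_integral_of_dominated_convergence (fun _ => M + 1) (fun k => ?_)
      (integrable_const _) (fun k => Eventually.of_forall fun s => ?_)
      (Eventually.of_forall fun s => ?_)
    · exact ((T.continuous_op _).sub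
        ((continuous_cexp_neg_mul _).smul continuous_const)).aestronglyMeasurable
    · refine (norm_sub_le _ _).trans (add_le_add ?_ ?_)
      · simpa [hx1] using hM s (x k)
      · rw [norm_smul, hx1, mul_one]
        exact norm_cexp_neg_mul_le (by simp) s
    · refine squeeze_zero_norm (a := fun k : ℕ => M * (1 / ((k : ℝ) + 1)) * s) (fun k => ?_) ?_
      · refine (norm_cexp_smul_op_sub_le hM (hy k) r s).trans ?_
        have := hxy k
        gcongr
      · have := (tendsto_one_div_add_atTop_nhds_zero_nat (𝕜 := ℝ)).const_mul M |>.mul_const (s : ℝ)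
        simpa using this
  have hle : ∀ k, ‖l‖ - ‖S (x k) - l • x k‖ ≤ ‖S‖ := by
    intro k
    have h1 : ‖l • x k‖ ≤ ‖S (x k)‖ + ‖S (x k) - l • x k‖ := by
      rw [← norm_neg (S (x k) - _), neg_sub]
      have := norm_add_le (S (x k)) (l • x k - S (x k))
      simpa using this
    have h2 := S.le_opNorm (x k)
    rw [norm_smul, hx1, mul_one] at h1
    rw [hx1, mul_one] at h2
    linarith
  have := (tendsto_const_nhds (x := ‖l‖)).sub hconv.norm
  rw [norm_zero, sub_zero] at this
  exact le_of_tendsto this (Eventually.of_forall hle)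

/-- If `ran A` is dense, then `A (1 + A)⁻¹ = 1 - (1 + A)⁻¹` is injective. -/
theorem injective_one_sub_resolvent {T : C0Semigroup X} (hT : T.IsBounded) {A : X →ₗ.[ℂ] X}
    (hA : T.generator = -A) (hran : Dense (Set.range fun x : A.domain => A x))
    {R : X →L[ℂ] X} (hR : HasHPRep T (fun z => (1 + z)⁻¹) R) :
    Function.Injective (1 - R : X →L[ℂ] X) := by
  obtain ⟨M, hM0, hM⟩ := hT.exists_bound
  rw [injective_iff_map_eq_zero]
  intro x hx
  have hfix : ∀ t, T.op t x = x := by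
    intro t
    obtain ⟨V, hV, -⟩ := exists_hasHPRep_integral hT t
    have h1 := (HasHPRep.one (T := T)).sub (HasHPRep.op t)
    -- In symbols: `1 - e^{-tz} = ((1 - e^{-tz}) / z + 1 - e^{-tz}) · z / (1 + z)`. Hence a vector
    -- killed by `1 - R` is fixed by the semigroup.
    have h2 := (hV.add h1).mul hT ((HasHPRep.one (T := T)).sub hR)
    have h3 := h1.unique hT (h2.congr fun z hz => by
      have hz0 : z ≠ 0 := by rintro rfl; simp at hz
      have hlz : 1 + z ≠ 0 := by
        intro h0
        have := congrArg Complex.re h0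
        simp only [Complex.add_re, Complex.zero_re, Complex.one_re] at this
        linarith
      field_simp
      ring)
    have h4 := congrArg (fun U : X →L[ℂ] X => U x) h3
    simp only [mul_apply_eq_comp, hx, map_zero] at h4
    rw [sub_apply, sub_eq_zero] at h4
    exact h4.symm
  rw [← norm_le_zero_iff]
  refine le_of_forall_pos_le_add fun ε hε => ?_
  -- A mean ergodic argument: time averages fix `x` but send `A w` to `(w - T(t) w) / t`, which
  -- vanishes as `t` grows. As `A w` is close to `x`, this forces `x = 0`.
  obtain ⟨_, ⟨w, rfl⟩, hw⟩ := Metric.mem_closure_iff.1 (hran x) (ε / (2 * M)) (by positivity)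
  rw [dist_eq_norm] at hw
  have hgraph : ((w : X), -A w) ∈ T.generatorGraph :=
    (mem_generatorGraph_iff hA _ _).2 ⟨w.2, by simp⟩
  set t : ℝ≥0 := Real.toNNReal (2 * (M + 1) * ‖(w : X)‖ / ε + 1) with ht
  have ht' : (t : ℝ) = 2 * (M + 1) * ‖(w : X)‖ / ε + 1 := Real.coe_toNNReal _ (by positivity)
  have ht0 : 0 < (t : ℝ) := by rw [ht']; positivity
  have h1 : ∫ s in (0 : ℝ)..t, T.op s.toNNReal (x - A w) = ((t : ℝ) • x + T.op t w) - w := by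
    have h2 := integral_cexp_smul_op hgraph 0 t
    simp only [zero_mul, Complex.exp_zero, one_smul, zero_smul, add_zero] at h2
    have h3 : ∀ s : ℝ, T.op s.toNNReal (x - A w) = x + T.op s.toNNReal (-A w) := fun s => by
      rw [sub_eq_add_neg, map_add, hfix]
    simp only [h3]
    rw [intervalIntegral.integral_add (by simp)
      ((T.continuous_op_toNNReal _).intervalIntegrable _ _), h2, intervalIntegral.integral_const,
      sub_zero, add_sub_assoc]
  have h2 : ‖∫ s in (0 : ℝ)..t, T.op s.toNNReal (x - A w)‖ ≤ M * (ε / (2 * M)) * |(t : ℝ) - 0| := by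
    refine intervalIntegral.norm_integral_le_of_norm_le_const fun s _ => ?_
    exact (hM _ _).trans (by gcongr)
  rw [h1, sub_zero, abs_of_pos ht0] at h2
  have h3 : ‖(t : ℝ) • x‖ ≤ M * (ε / (2 * M)) * t + M * ‖(w : X)‖ + ‖(w : X)‖ := by
    have h4 : (t : ℝ) • x = ((t : ℝ) • x + T.op t w - w) - T.op t w + w := by abel
    rw [h4]
    refine (norm_add_le _ _).trans (add_le_add ((norm_sub_le _ _).trans (add_le_add h2 (hM _ _))) le_rfl)
  rw [norm_smul, Real.norm_of_nonneg ht0.le] at h3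
  have h4 : M * (ε / (2 * M)) = ε / 2 := by field_simp
  have h5 : 2 * (M + 1) * ‖(w : X)‖ ≤ ε * t := by
    rw [ht', mul_add ε, mul_div_cancel₀ _ hε.ne']
    linarith
  rw [h4] at h3
  have h6 : (t : ℝ) * ‖x‖ ≤ t * (0 + ε) := by linarith
  exact le_of_mul_le_mul_left h6 ht0

end Semigroup

/-! ### Symbols in the Hille-Phillips algebra -/

section Symbols

theorem one_add_ne_zero_of_re_pos {z : ℂ} (hz : 0 < z.re) : 1 + z ≠ 0 := by
  intro h0
  have := congrArg Complex.re h0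
  simp only [Complex.add_re, Complex.zero_re, Complex.one_re] at this
  linarith

theorem ne_zero_of_re_pos {z : ℂ} (hz : 0 < z.re) : z ≠ 0 := by
  rintro rfl
  simp at hz

theorem isOpen_re_pos : IsOpen {z : ℂ | 0 < z.re} := isOpen_lt continuous_const Complex.continuous_re

theorem differentiableOn_cpow_re_pos (c : ℂ) :
    DifferentiableOn ℂ (fun z : ℂ => z ^ c) {z : ℂ | 0 < z.re} := fun _ hz =>
  (DifferentiableAt.cpow_const differentiableAt_id (Or.inl hz)).differentiableWithinAt

variable {X : Type*} [NormedAddCommGroup X] [NormedSpace ℂ X]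

/-- Each Laplace transform is the complex moment generating function at `-z`, holomorphic where the
real part lies in the interior of the integrability set. Holomorphy lets symbol identities be
checked on `(0, ∞)` only. -/
theorem HasHPRep.differentiableOn {T : C0Semigroup X} {f : ℂ → ℂ} {S : X →L[ℂ] X}
    (h : HasHPRep T f S) : DifferentiableOn ℂ f {z : ℂ | 0 < z.re} := by
  obtain ⟨ι, _, c, m, hm, hf, -⟩ := h
  have h1 : DifferentiableOn ℂ (fun z => ∑ i, c i *
      ProbabilityTheory.complexMGF (fun s : ℝ≥0 => (s : ℝ)) (m i) (-z)) {z : ℂ | 0 < z.re} := by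
    refine DifferentiableOn.fun_sum fun i _ => DifferentiableOn.const_mul ?_ _
    have := hm i
    refine DifferentiableOn.fun_comp ProbabilityTheory.differentiableOn_complexMGF
      (differentiableOn_id.neg) fun z hz => ?_
    have hsub : Iio (0 : ℝ) ⊆ ProbabilityTheory.integrableExpSet (fun s : ℝ≥0 => (s : ℝ)) (m i) := by
      intro t ht
      have ht' : t < 0 := ht
      refine Continuous.integrable_of_norm_le (C := 1) (by fun_prop) (fun s => ?_) _
      rw [Real.norm_of_nonneg (Real.exp_pos _).le, Real.exp_le_one_iff]
      exact mul_nonpos_of_nonpos_of_nonneg ht'.le s.coe_nonneg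
    have hz' : 0 < z.re := hz
    refine interior_maximal hsub isOpen_Iio ?_
    simpa using hz'
  refine h1.congr fun z hz => ?_
  rw [hf z hz]
  simp only [ProbabilityTheory.complexMGF, neg_mul]

/-- Two holomorphic functions on the right half-plane that agree on `(0, ∞)` are equal. -/
theorem eqOn_re_pos_of_eq_real {f g : ℂ → ℂ} (hf : DifferentiableOn ℂ f {z : ℂ | 0 < z.re})
    (hg : DifferentiableOn ℂ g {z : ℂ | 0 < z.re}) (h : ∀ x : ℝ, 0 < x → f x = g x) :
    EqOn f g {z : ℂ | 0 < z.re} := by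
  refine (hf.analyticOnNhd isOpen_re_pos).eqOn_of_preconnected_of_frequently_eq
    (hg.analyticOnNhd isOpen_re_pos) (convex_halfSpace_re_gt 0).isPreconnected
    (show (1 : ℂ) ∈ {z : ℂ | 0 < z.re} by simp) ?_
  have h1 : Tendsto (fun n : ℕ => (((1 + 1 / ((n : ℝ) + 1) : ℝ)) : ℂ)) atTop (𝓝[≠] 1) := by
    refine tendsto_nhdsWithin_iff.2 ⟨?_, Eventually.of_forall fun n => ?_⟩
    · have := (tendsto_one_div_add_atTop_nhds_zero_nat (𝕜 := ℝ)).const_add 1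
      rw [add_zero] at this
      exact_mod_cast (Complex.continuous_ofReal.tendsto 1).comp this
    · have : (1 + 1 / ((n : ℝ) + 1) : ℝ) ≠ 1 := by
        have : 0 < 1 / ((n : ℝ) + 1) := by positivity
        linarith
      simpa only [mem_compl_iff, mem_singleton_iff, Complex.ofReal_eq_one] using this
  exact h1.frequently (Eventually.of_forall fun n => h _ (by positivity)).frequently

/-- For `0 < γ < 1` the tail `v ^ (γ - 1)` is not integrable, hence not the density of a bounded
measure. Integration by parts trades it for the integrable `v ^ (γ - 2)` at the price of a factor `1
/ x`. -/
theorem integral_Ioi_rpow_mul_exp_by_parts {γ x : ℝ} (hγ : γ < 1) (hx : 0 < x) :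
    x * ∫ v in Ioi (1 : ℝ), v ^ (γ - 1) * Real.exp (-(x * v)) =
      Real.exp (-x) + (γ - 1) * ∫ v in Ioi (1 : ℝ), v ^ (γ - 2) * Real.exp (-(x * v)) := by
  have hexp : IntegrableOn (fun v : ℝ => Real.exp (-(x * v))) (Ioi 1) := by
    simpa only [neg_mul] using integrableOn_exp_mul_Ioi (a := -x) (by linarith) 1
  have hint : ∀ p : ℝ, p ≤ 0 →
      IntegrableOn (fun v : ℝ => v ^ p * Real.exp (-(x * v))) (Ioi 1) := by
    intro p hp
    refine Integrable.mono' hexp ?_ ?_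
    · refine ContinuousOn.aestronglyMeasurable (fun v hv => ?_) measurableSet_Ioi
      have hv' : (1 : ℝ) < v := hv
      exact ((Real.continuousAt_rpow_const v p (Or.inl (by linarith))).mul
        (by fun_prop)).continuousWithinAt
    · filter_upwards [ae_restrict_mem measurableSet_Ioi] with v hv
      have hv' : (1 : ℝ) < v := hv
      have h0 : 0 ≤ v ^ p := Real.rpow_nonneg (by linarith) _
      rw [Real.norm_of_nonneg (mul_nonneg h0 (Real.exp_pos _).le)]
      exact mul_le_of_le_one_left (Real.exp_pos _).le
        (Real.rpow_le_one_of_one_le_of_nonpos hv'.le hp)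
  have h1 := hint (γ - 1) (by linarith)
  have h2 := hint (γ - 2) (by linarith)
  have hderiv : ∀ v ∈ Ici (1 : ℝ), HasDerivAt (fun v : ℝ => v ^ (γ - 1) * Real.exp (-(x * v)))
      ((γ - 1) * (v ^ (γ - 2) * Real.exp (-(x * v))) -
        x * (v ^ (γ - 1) * Real.exp (-(x * v)))) v := by
    intro v hv
    have hv' : (1 : ℝ) ≤ v := hv
    have d1 := Real.hasDerivAt_rpow_const (x := v) (p := γ - 1) (Or.inl (by linarith))
    have d2 : HasDerivAt (fun v : ℝ => Real.exp (-(x * v))) (Real.exp (-(x * v)) * -(x * 1)) v :=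
      (((hasDerivAt_id v).const_mul x).neg).exp
    refine (d1.mul d2).congr_deriv ?_
    rw [show γ - 1 - 1 = γ - 2 by ring]
    ring
  have hlim : Tendsto (fun v : ℝ => v ^ (γ - 1) * Real.exp (-(x * v))) atTop (𝓝 0) := by
    have := tendsto_rpow_mul_exp_neg_mul_atTop_nhds_zero (γ - 1) x hx
    simpa only [neg_mul] using this
  have h3 := integral_Ioi_of_hasDerivAt_of_tendsto' hderiv
    ((h2.const_mul (γ - 1)).sub (h1.const_mul x)) hlim
  rw [integral_sub (h2.const_mul _) (h1.const_mul _), integral_const_mul, integral_const_mul,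
    Real.one_rpow] at h3
  simp only [mul_one, one_mul, zero_sub] at h3
  linarith

theorem integrableOn_rpow_sub_one {γ : ℝ} (hγ : 0 < γ) :
    IntegrableOn (fun v : ℝ => v ^ (γ - 1)) (Ioc 0 1) :=
  (intervalIntegrable_iff_integrableOn_Ioc_of_le zero_le_one).1
    (intervalIntegral.intervalIntegrable_rpow' (by linarith))

/-- The Laplace representation of `x ^ (-γ)`, with the tail of the kernel integrated by parts. -/
theorem rpow_neg_mul_Gamma_eq {γ x : ℝ} (hγ0 : 0 < γ) (hγ : γ < 1) (hx : 0 < x) :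
    x ^ (-γ) * Real.Gamma γ = (∫ v in Ioc (0 : ℝ) 1, v ^ (γ - 1) * Real.exp (-(x * v))) +
      (Real.exp (-x) + (γ - 1) * ∫ v in Ioi (1 : ℝ), v ^ (γ - 2) * Real.exp (-(x * v))) / x := by
  rw [← integral_Ioi_rpow_mul_exp_by_parts hγ hx, mul_div_cancel_left₀ _ hx.ne']
  have h1 := Real.integral_rpow_mul_exp_neg_mul_Ioi hγ0 hx
  rw [one_div, Real.inv_rpow hx.le, ← Real.rpow_neg hx.le] at h1
  have h2 : IntegrableOn (fun v : ℝ => v ^ (γ - 1) * Real.exp (-(x * v))) (Ioi 0) := by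
    by_contra hcon
    rw [integral_undef hcon] at h1
    have : 0 < x ^ (-γ) * Real.Gamma γ :=
      mul_pos (Real.rpow_pos_of_pos hx _) (Real.Gamma_pos_of_pos hγ0)
    linarith
  rw [← h1, ← Ioc_union_Ioi_eq_Ioi (zero_le_one (α := ℝ)), setIntegral_union
    (Ioc_disjoint_Ioi le_rfl) measurableSet_Ioi (h2.mono_set Ioc_subset_Ioi_self)
    (h2.mono_set (Ioi_subset_Ioi zero_le_one))]

variable [CompleteSpace X]

/-- `z ^ (-γ) = a z + b z / z` with `a`, `b` in the Hille-Phillips algebra. -/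
theorem exists_hasHPRep_cpow_neg {T : C0Semigroup X} (hT : T.IsBounded) {γ : ℝ} (hγ0 : 0 < γ)
    (hγ : γ < 1) : ∃ (a b : ℂ → ℂ) (P Q : X →L[ℂ] X), HasHPRep T a P ∧ HasHPRep T b Q ∧
      ∀ z : ℂ, 0 < z.re → z ^ (-(γ : ℂ)) = a z + b z / z := by
  have hG : Real.Gamma γ ≠ 0 := (Real.Gamma_pos_of_pos hγ0).ne'
  obtain ⟨P, hP, -⟩ := HasHPRep.exists_of_density (T := T) hT (volume.restrict (Ioc (0 : ℝ) 1))
    (w := fun v => ((v ^ (γ - 1) : ℝ) : ℂ)) (integrableOn_rpow_sub_one hγ0).ofReal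
    (φ := Real.toNNReal) measurable_real_toNNReal
  obtain ⟨Q, hQ, -⟩ := HasHPRep.exists_of_density (T := T) hT (volume.restrict (Ioi (1 : ℝ)))
    (w := fun v => ((v ^ (γ - 2) : ℝ) : ℂ))
    (integrableOn_Ioi_rpow_of_lt (by linarith : γ - 2 < -1) one_pos).ofReal
    (φ := Real.toNNReal) measurable_real_toNNReal
  have ha := hP.smul ((Real.Gamma γ : ℂ)⁻¹)
  have hb := ((HasHPRep.op (T := T) 1).add (hQ.smul ((γ : ℂ) - 1))).smul ((Real.Gamma γ : ℂ)⁻¹)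
  refine ⟨_, _, _, _, ha, hb, ?_⟩
  refine eqOn_re_pos_of_eq_real (differentiableOn_cpow_re_pos _)
    (ha.differentiableOn.add (hb.differentiableOn.div differentiableOn_id
      fun z hz => ne_zero_of_re_pos hz)) fun x hx => ?_
  have hint : ∀ (s : Set ℝ) (p : ℝ), MeasurableSet s → s ⊆ Ioi 0 →
      ∫ y in s, Complex.exp (-((x : ℂ) * ((y.toNNReal : ℝ) : ℂ))) * ((y ^ p : ℝ) : ℂ) =
        ((∫ y in s, y ^ p * Real.exp (-(x * y)) : ℝ) : ℂ) := by
    intro s p hs hs0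
    rw [← integral_complex_ofReal]
    refine setIntegral_congr_fun hs fun y hy => ?_
    simp only [Real.coe_toNNReal y (le_of_lt (hs0 hy))]
    push_cast
    ring
  have h1 := rpow_neg_mul_Gamma_eq hγ0 hγ hx
  rw [← eq_div_iff hG] at h1
  have h2 : (x : ℂ) ^ (-(γ : ℂ)) = ((x ^ (-γ) : ℝ) : ℂ) := by
    rw [Complex.ofReal_cpow hx.le]
    push_cast
    rfl
  rw [h2, h1, hint _ _ measurableSet_Ioc Ioc_subset_Ioi_self,
    hint _ _ measurableSet_Ioi (Ioi_subset_Ioi zero_le_one)]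
  have hG' : (Real.Gamma γ : ℂ) ≠ 0 := by exact_mod_cast hG
  have hx' : (x : ℂ) ≠ 0 := by exact_mod_cast hx.ne'
  push_cast
  simp only [mul_one]
  field_simp

/-- `z ^ (-α) = a z + b z / z ^ 2` with `a`, `b` in the Hille-Phillips algebra. -/
theorem exists_hasHPRep_cpow_neg_sq {T : C0Semigroup X} (hT : T.IsBounded) {α : ℝ} (hα0 : 0 < α)
    (hα : α ≤ 2) : ∃ (a b : ℂ → ℂ) (P Q : X →L[ℂ] X), HasHPRep T a P ∧ HasHPRep T b Q ∧
      ∀ z : ℂ, 0 < z.re → z ^ (-(α : ℂ)) = a z + b z / z ^ 2 := by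
  rcases hα.lt_or_eq with hα | rfl
  · obtain ⟨a, b, P, Q, ha, hb, hab⟩ := exists_hasHPRep_cpow_neg hT (γ := α / 2) (by linarith)
      (by linarith)
    obtain ⟨R, hR⟩ := exists_hasHPRep_resolvent hT (l := 1) (by simp)
    -- Square `z ^ (-α/2) = a + b / z`, which is available since `α / 2 < 1`. The cross term `2ab /
    -- z` is distributed by `1 / z = 1 / (1 + z) + (z / (1 + z)) / z²`.
    refine ⟨_, _, _, _, (ha.mul hT ha).add (((ha.mul hT hb).smul 2).mul hT hR),
      (hb.mul hT hb).add (((ha.mul hT hb).smul 2).mul hT ((HasHPRep.one).sub hR)),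
      fun z hz => ?_⟩
    have hz0 := ne_zero_of_re_pos hz
    have hz1 := one_add_ne_zero_of_re_pos hz
    have h1 : z ^ (-(α : ℂ)) = z ^ (-((α / 2 : ℝ) : ℂ)) * z ^ (-((α / 2 : ℝ) : ℂ)) := by
      rw [← Complex.cpow_add _ _ hz0]
      congr 1
      push_cast
      ring
    rw [h1, hab z hz]
    field_simp
    ring
  · refine ⟨_, _, _, _, (HasHPRep.one (T := T)).smul 0, HasHPRep.one, fun z hz => ?_⟩
    rw [Complex.cpow_neg]
    norm_num

/-- The negative fractional powers have a regularizer. -/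
theorem exists_isRegularizer_cpow_neg {T : C0Semigroup X} (hT : T.IsBounded) {A : X →ₗ.[ℂ] X}
    (hA : T.generator = -A) (hran : Dense (Set.range fun x : A.domain => A x)) {α : ℝ}
    (hα0 : 0 < α) (hα : α ≤ 2) : ∃ e, IsRegularizer T (fun z : ℂ => z ^ (-(α : ℂ))) e := by
  obtain ⟨a, b, P, Q, ha, hb, hab⟩ := exists_hasHPRep_cpow_neg_sq hT hα0 hα
  obtain ⟨R, hR⟩ := exists_hasHPRep_resolvent hT (l := 1) (by simp)
  -- The regularizer is `e z = (z / (1 + z))²`: then `e · z ^ (-α) = a e + b / (1 + z)²`, and `e(A)`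
  -- is injective because `ran A` is dense.
  have he := ((HasHPRep.one (T := T)).sub hR).pow hT 2
  refine ⟨_, differentiableOn_cpow_re_pos _, he.mem_HPAlgebra hT, ?_, ?_⟩
  · refine HasHPRep.mem_HPAlgebra hT (((ha.mul hT he).add (hb.mul hT (hR.pow hT 2))).congr
      fun z hz => ?_)
    have hz0 := ne_zero_of_re_pos hz
    have hz1 := one_add_ne_zero_of_re_pos hz
    beta_reduce
    rw [hab z hz]
    field_simp
    ring
  · rw [he.hpOp_eq hT, pow_two]
    have hinj := injective_one_sub_resolvent hT hA hran hR
    exact hinj.comp hinj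

omit [CompleteSpace X] in
theorem C0Semigroup.IsBounded.rescale {T : C0Semigroup X} (hT : T.IsBounded) (r : ℝ≥0) :
    (T.rescale r).IsBounded := by
  obtain ⟨M, hM⟩ := hT
  exact ⟨M, fun t => hM _⟩

omit [CompleteSpace X] in
theorem HasHPRep.of_rescale {T : C0Semigroup X} {r : ℝ≥0} (hr : 0 < r) {f : ℂ → ℂ}
    {S : X →L[ℂ] X} (h : HasHPRep (T.rescale r) f S) :
    HasHPRep T (fun z => f (((r : ℝ) : ℂ) * z)) S := by
  obtain ⟨ι, _, c, m, hm, hf, hS⟩ := h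
  have hmeas : Measurable fun s : ℝ≥0 => r * s := by fun_prop
  refine ⟨ι, inferInstance, c, fun i => (m i).map fun s => r * s, fun i => ?_, fun z hz => ?_,
    fun x => ?_⟩
  · have := hm i
    exact Measure.isFiniteMeasure_map _ _
  · beta_reduce
    rw [hf _ (by
      rw [Complex.re_ofReal_mul]
      exact mul_pos (by exact_mod_cast hr) hz)]
    refine Finset.sum_congr rfl fun i _ => ?_
    rw [integral_map hmeas.aemeasurable (continuous_cexp_neg_mul z).aestronglyMeasurable]
    congr 1
    refine integral_congr_ae (Eventually.of_forall fun s => ?_)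
    simp only [NNReal.coe_mul, Complex.ofReal_mul]
    ring_nf
  · rw [hS]
    refine Finset.sum_congr rfl fun i _ => ?_
    rw [integral_map hmeas.aemeasurable (T.continuous_op x).aestronglyMeasurable]
    rfl

/-- Taylor's formula for `e^{-c}` with integral remainder, multiplied out so that `c = 0` is
included. -/
theorem integral_one_sub_mul_cexp (c : ℂ) :
    c ^ 2 * ∫ θ in (0 : ℝ)..1, (1 - (θ : ℂ)) * Complex.exp (-(c * θ)) =
      Complex.exp (-c) - 1 + c := by
  have hd : ∀ θ : ℝ, HasDerivAt (fun θ : ℝ => Complex.exp (-(c * θ)) * (1 - c * (1 - (θ : ℂ))))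
      (c ^ 2 * ((1 - (θ : ℂ)) * Complex.exp (-(c * θ)))) θ := by
    intro θ
    have d0 : HasDerivAt (fun θ : ℝ => (θ : ℂ)) 1 θ := Complex.ofRealCLM.hasDerivAt
    have d1 := ((d0.const_mul c).fun_neg).cexp
    have d2 := ((d0.const_sub 1).const_mul c).const_sub 1
    refine (d1.fun_mul d2).congr_deriv ?_
    ring
  rw [← intervalIntegral.integral_const_mul,
    intervalIntegral.integral_eq_sub_of_hasDerivAt (fun θ _ => hd θ)
      (Continuous.intervalIntegrable (by fun_prop) _ _)]
  simp
  ring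

omit [CompleteSpace X] in
/-- If `ν` is a probability measure with mean `1` and finite variance, then
`(g(z) - e^{-z}) / z ^ 2` is in the Hille-Phillips algebra. -/
theorem exists_hasHPRep_remainder {T : C0Semigroup X} (hT : T.IsBounded) (ν : Measure ℝ≥0)
    [IsProbabilityMeasure ν] (h1 : Integrable (fun s : ℝ≥0 => (s : ℝ)) ν)
    (hmean : ∫ s : ℝ≥0, (s : ℝ) ∂ν = 1) (h2 : Integrable (fun s : ℝ≥0 => (s : ℝ) ^ 2) ν) :
    ∃ S : X →L[ℂ] X, HasHPRep T (fun z => ((∫ s : ℝ≥0, Complex.exp (-(z * ((s : ℝ) : ℂ))) ∂ν) -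
      Complex.exp (-z)) / z ^ 2) S := by
  have hsq : Integrable (fun s : ℝ≥0 => (((s : ℝ) : ℂ) - 1) ^ 2) ν := by
    have : Integrable (fun s : ℝ≥0 => (((s : ℝ) ^ 2 - 2 * (s : ℝ) + 1 : ℝ) : ℂ)) ν :=
      ((h2.sub (h1.const_mul 2)).add (integrable_const 1)).ofReal
    refine this.congr (Eventually.of_forall fun s => ?_)
    push_cast
    ring
  have hθ : Integrable (fun θ : ℝ => 1 - (θ : ℂ)) (volume.restrict (Ioc (0 : ℝ) 1)) :=
    (Continuous.integrableOn_Ioc (by fun_prop))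
  -- Taylor at `s = 1` gives the density `(s - 1)² (1 - θ)` at time `1 + θ (s - 1)`, a convex
  -- combination of `1` and `s`, hence nonnegative. The first-order term `(s - 1) z e^{-z}`
  -- integrates to zero because the mean is `1`.
  obtain ⟨S, hS, -⟩ := HasHPRep.exists_of_density (T := T) hT
    (ν.prod (volume.restrict (Ioc (0 : ℝ) 1))) (hsq.mul_prod hθ)
    (φ := fun p : ℝ≥0 × ℝ => Real.toNNReal (1 + p.2 * ((p.1 : ℝ) - 1))) (by fun_prop)
  refine ⟨S, hS.congr fun z hz => ?_⟩
  have hz0 := ne_zero_of_re_pos hz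
  have hprod : Integrable (fun p : ℝ≥0 × ℝ =>
      Complex.exp (-(z * ((Real.toNNReal (1 + p.2 * ((p.1 : ℝ) - 1)) : ℝ) : ℂ))) *
        ((((p.1 : ℝ) : ℂ) - 1) ^ 2 * (1 - (p.2 : ℂ)))) (ν.prod (volume.restrict (Ioc (0 : ℝ) 1))) :=
    (hsq.mul_prod hθ).bdd_mul (c := 1) (by
      refine Measurable.aestronglyMeasurable ?_
      fun_prop) (Eventually.of_forall fun p => norm_cexp_neg_mul_le hz.le _)
  rw [integral_prod _ hprod, eq_comm, eq_div_iff (pow_ne_zero 2 hz0), ← integral_mul_const]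
  have hinner : ∀ s : ℝ≥0, (∫ θ in Ioc (0 : ℝ) 1,
      Complex.exp (-(z * ((Real.toNNReal (1 + θ * ((s : ℝ) - 1)) : ℝ) : ℂ))) *
        ((((s : ℝ) : ℂ) - 1) ^ 2 * (1 - (θ : ℂ)))) * z ^ 2 =
      Complex.exp (-(z * ((s : ℝ) : ℂ))) - Complex.exp (-z) +
        (((s : ℝ) : ℂ) - 1) * (z * Complex.exp (-z)) := by
    intro s
    have h3 := integral_one_sub_mul_cexp (z * (((s : ℝ) : ℂ) - 1))
    have h4 : (∫ θ in Ioc (0 : ℝ) 1,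
        Complex.exp (-(z * ((Real.toNNReal (1 + θ * ((s : ℝ) - 1)) : ℝ) : ℂ))) *
        ((((s : ℝ) : ℂ) - 1) ^ 2 * (1 - (θ : ℂ)))) =
        (((s : ℝ) : ℂ) - 1) ^ 2 * Complex.exp (-z) * ∫ θ in (0 : ℝ)..1,
          (1 - (θ : ℂ)) * Complex.exp (-(z * (((s : ℝ) : ℂ) - 1) * θ)) := by
      rw [intervalIntegral.integral_of_le zero_le_one, ← integral_const_mul]
      refine setIntegral_congr_fun measurableSet_Ioc fun θ hθ => ?_
      have hnn : 0 ≤ 1 + θ * ((s : ℝ) - 1) := by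
        have := mul_nonneg hθ.1.le s.coe_nonneg
        have := hθ.2
        linarith
      simp only [Real.coe_toNNReal _ hnn]
      have h5 : Complex.exp (-(z * ((1 + θ * ((s : ℝ) - 1) : ℝ) : ℂ))) =
          Complex.exp (-z) * Complex.exp (-(z * (((s : ℝ) : ℂ) - 1) * θ)) := by
        rw [← Complex.exp_add]
        congr 1
        push_cast
        ring
      rw [h5]
      ring
    have h6 : Complex.exp (-(z * ((s : ℝ) : ℂ))) =
        Complex.exp (-z) * Complex.exp (-(z * (((s : ℝ) : ℂ) - 1))) := by
      rw [← Complex.exp_add]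
      congr 1
      ring
    rw [h4, h6]
    linear_combination Complex.exp (-z) * h3
  simp only [hinner]
  have hi1 : Integrable (fun s : ℝ≥0 => Complex.exp (-(z * ((s : ℝ) : ℂ)))) ν :=
    (continuous_cexp_neg_mul z).integrable_of_norm_le (norm_cexp_neg_mul_le hz.le) _
  have hi2 : Integrable (fun s : ℝ≥0 => ((s : ℝ) : ℂ)) ν := h1.ofReal
  have hi3 : Integrable (fun s : ℝ≥0 => Complex.exp (-(z * ((s : ℝ) : ℂ))) - Complex.exp (-z)) ν :=
    hi1.sub (integrable_const _)
  have hi4 : Integrable (fun s : ℝ≥0 => (((s : ℝ) : ℂ) - 1) * (z * Complex.exp (-z))) ν :=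
    (hi2.sub (integrable_const _)).mul_const _
  rw [integral_add hi3 hi4, integral_sub hi1 (integrable_const _),
    integral_mul_const, integral_sub hi2 (integrable_const _), integral_complex_ofReal, hmean]
  simp

end Symbols

/-! ### Moments of the representing measure -/

section Moments

variable {g : ℝ → ℝ} {ν : Measure ℝ≥0} [IsFiniteMeasure ν]

theorem Ioi_subset_interior_integrableExpSet_neg :
    Ioi 0 ⊆ interior (ProbabilityTheory.integrableExpSet (fun s : ℝ≥0 => -(s : ℝ)) ν) := by
  refine interior_maximal (fun t ht => ?_) isOpen_Ioi
  have ht' : 0 < t := ht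
  refine Continuous.integrable_of_norm_le (C := 1) (by fun_prop) (fun s => ?_) _
  rw [Real.norm_of_nonneg (Real.exp_pos _).le, Real.exp_le_one_iff]
  exact mul_nonpos_of_nonneg_of_nonpos ht'.le (neg_nonpos.2 s.coe_nonneg)

theorem IsLaplaceTransformOf.iteratedDeriv_eq (h : IsLaplaceTransformOf g ν) (n : ℕ) {t : ℝ}
    (ht : 0 < t) : iteratedDeriv n g t = ∫ s : ℝ≥0, (-(s : ℝ)) ^ n * Real.exp (-(t * (s : ℝ))) ∂ν := by
  have h1 : g =ᶠ[𝓝 t] ProbabilityTheory.mgf (fun s : ℝ≥0 => -(s : ℝ)) ν := by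
    filter_upwards [Ioi_mem_nhds ht] with x hx
    rw [h x hx]
    simp [ProbabilityTheory.mgf]
  rw [h1.iteratedDeriv_eq, ProbabilityTheory.iteratedDeriv_mgf
    (Ioi_subset_interior_integrableExpSet_neg ht)]
  simp

theorem IsLaplaceTransformOf.integrable_pow_mul_exp (n : ℕ) {t : ℝ} (ht : 0 < t) :
    Integrable (fun s : ℝ≥0 => (-(s : ℝ)) ^ n * Real.exp (-(t * (s : ℝ)))) ν := by
  have := ProbabilityTheory.integrable_pow_mul_exp_of_mem_interior_integrableExpSet
    (Ioi_subset_interior_integrableExpSet_neg (ν := ν) ht) n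
  simpa using this

theorem IsLaplaceTransformOf.isProbabilityMeasure (h : IsLaplaceTransformOf g ν)
    (h0 : Tendsto g (𝓝[>] 0) (𝓝 1)) : IsProbabilityMeasure ν := by
  have h1 : ν.real univ = 1 := by
    refine tendsto_nhds_unique (tendsto_integral_exp_neg_mul_zero ν) (h0.congr' ?_)
    filter_upwards [self_mem_nhdsWithin] with t ht
    exact h t ht
  refine ⟨?_⟩
  rw [measureReal_def] at h1
  rw [← ENNReal.ofReal_toReal (measure_ne_top ν univ), h1, ENNReal.ofReal_one]

/-- Fatou's lemma along `t = 1 / (k + 1)`: the integrals of `s² e^{-ts}` are `g''(t)`, which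
converge to a finite limit. -/
theorem IsLaplaceTransformOf.integrable_sq (h : IsLaplaceTransformOf g ν) {L : ℝ}
    (hL : Tendsto (iteratedDeriv 2 g) (𝓝[>] 0) (𝓝 L)) :
    Integrable (fun s : ℝ≥0 => (s : ℝ) ^ 2) ν := by
  set u : ℕ → ℝ := fun k => 1 / ((k : ℝ) + 1)
  have hu0 : ∀ k, 0 < u k := fun k => by positivity
  have hu : Tendsto u atTop (𝓝[>] 0) :=
    tendsto_nhdsWithin_iff.2 ⟨tendsto_one_div_add_atTop_nhds_zero_nat, Eventually.of_forall hu0⟩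
  refine ⟨by fun_prop, ?_⟩
  rw [hasFiniteIntegral_iff_ofReal (Eventually.of_forall fun s => by positivity)]
  have h1 : ∀ k, ∫⁻ s : ℝ≥0, ENNReal.ofReal ((-(s : ℝ)) ^ 2 * Real.exp (-(u k * (s : ℝ)))) ∂ν =
      ENNReal.ofReal (iteratedDeriv 2 g (u k)) := fun k => by
    rw [h.iteratedDeriv_eq 2 (hu0 k), ofReal_integral_eq_lintegral_ofReal
      (integrable_pow_mul_exp 2 (hu0 k)) (Eventually.of_forall fun s => by positivity)]
  have h2 : Tendsto (fun k => ENNReal.ofReal (iteratedDeriv 2 g (u k))) atTop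
      (𝓝 (ENNReal.ofReal L)) := ENNReal.tendsto_ofReal (hL.comp hu)
  have h3 := lintegral_liminf_le (μ := ν) (u := atTop) (f := fun (k : ℕ) (s : ℝ≥0) =>
    ENNReal.ofReal ((-(s : ℝ)) ^ 2 * Real.exp (-(u k * (s : ℝ))))) (fun k => by fun_prop)
  simp only [h1, h2.liminf_eq] at h3
  refine (lintegral_mono fun s => ?_).trans_lt (h3.trans_lt ENNReal.ofReal_lt_top)
  refine le_of_eq (Tendsto.liminf_eq ?_).symm
  refine ENNReal.tendsto_ofReal ?_
  have h4 : Tendsto (fun t : ℝ => (-(s : ℝ)) ^ 2 * Real.exp (-(t * (s : ℝ)))) (𝓝 0)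
      (𝓝 ((-(s : ℝ)) ^ 2 * Real.exp (-(0 * (s : ℝ))))) := Continuous.tendsto (by fun_prop) 0
  simpa [Function.comp_def] using h4.comp (hu.mono_right nhdsWithin_le_nhds)

theorem integrable_of_integrable_sq (h : Integrable (fun s : ℝ≥0 => (s : ℝ) ^ 2) ν) :
    Integrable (fun s : ℝ≥0 => (s : ℝ)) ν := by
  refine Integrable.mono' (h.add (integrable_const (1 : ℝ))) (by fun_prop)
    (Eventually.of_forall fun s => ?_)
  rw [Real.norm_of_nonneg s.coe_nonneg]
  simp only [Pi.add_apply]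
  nlinarith [sq_nonneg ((s : ℝ) - 1), s.coe_nonneg]

theorem IsLaplaceTransformOf.integral_eq_one (h : IsLaplaceTransformOf g ν)
    (h1 : Tendsto (deriv g) (𝓝[>] 0) (𝓝 (-1)))
    (hi : Integrable (fun s : ℝ≥0 => (s : ℝ)) ν) : ∫ s : ℝ≥0, (s : ℝ) ∂ν = 1 := by
  have h2 : Tendsto (fun t : ℝ => ∫ s : ℝ≥0, (-(s : ℝ)) ^ 1 * Real.exp (-(t * (s : ℝ))) ∂ν) (𝓝[>] 0)
      (𝓝 (∫ s : ℝ≥0, -(s : ℝ) ∂ν)) := by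
    refine tendsto_integral_filter_of_dominated_convergence (fun s => (s : ℝ)) ?_ ?_ hi ?_
    · exact Eventually.of_forall fun t => by fun_prop
    · filter_upwards [self_mem_nhdsWithin] with t ht
      refine Eventually.of_forall fun s => ?_
      have ht' : 0 < t := ht
      rw [norm_mul, pow_one, norm_neg, Real.norm_of_nonneg s.coe_nonneg,
        Real.norm_of_nonneg (Real.exp_pos _).le]
      refine mul_le_of_le_one_right s.coe_nonneg ?_
      rw [Real.exp_le_one_iff, Left.neg_nonpos_iff]
      positivity
    · refine Eventually.of_forall fun s => ?_
      have h4 : Tendsto (fun t : ℝ => (-(s : ℝ)) ^ 1 * Real.exp (-(t * (s : ℝ)))) (𝓝 0)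
          (𝓝 ((-(s : ℝ)) ^ 1 * Real.exp (-(0 * (s : ℝ))))) := Continuous.tendsto (by fun_prop) 0
      simpa using h4.mono_left nhdsWithin_le_nhds
  have h3 := tendsto_nhds_unique h1 (h2.congr' (by
    filter_upwards [self_mem_nhdsWithin] with t ht
    rw [← iteratedDeriv_one, h.iteratedDeriv_eq 1 ht]))
  rw [integral_neg] at h3
  linarith

end Moments

/-! ### Characteristic functions near the origin -/

section CharacteristicFunction

variable {ν : Measure ℝ≥0} [IsProbabilityMeasure ν]

/-- Symmetrization: the squared modulus is the characteristic function of the difference of two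
independent copies, which is real. -/
theorem norm_laplace_imaginary_sq (y : ℝ) :
    ‖∫ s : ℝ≥0, Complex.exp (-(Complex.I * y * ((s : ℝ) : ℂ))) ∂ν‖ ^ 2 =
      ∫ p : ℝ≥0 × ℝ≥0, Real.cos (y * ((p.1 : ℝ) - p.2)) ∂(ν.prod ν) := by
  have hi : Integrable (fun s : ℝ≥0 => Complex.exp (-(Complex.I * y * ((s : ℝ) : ℂ)))) ν :=
    (continuous_cexp_neg_mul _).integrable_of_norm_le (norm_cexp_neg_mul_le (by simp)) _
  have hre : (∫ s : ℝ≥0, Complex.exp (-(Complex.I * y * ((s : ℝ) : ℂ))) ∂ν).re =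
      ∫ s : ℝ≥0, Real.cos (y * s) ∂ν := by
    have := integral_re hi
    simp only [RCLike.re_to_complex] at this
    rw [← this]
    refine integral_congr_ae (Eventually.of_forall fun s => ?_)
    simp [Complex.exp_re]
  have him : (∫ s : ℝ≥0, Complex.exp (-(Complex.I * y * ((s : ℝ) : ℂ))) ∂ν).im =
      -∫ s : ℝ≥0, Real.sin (y * s) ∂ν := by
    have := integral_im hi
    simp only [RCLike.im_to_complex] at this
    rw [← this, ← integral_neg]
    refine integral_congr_ae (Eventually.of_forall fun s => ?_)
    simp [Complex.exp_im]
  have hc : Integrable (fun s : ℝ≥0 => Real.cos (y * s)) ν :=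
    Continuous.integrable_of_norm_le (by fun_prop) (fun s => Real.abs_cos_le_one _) _
  have hs : Integrable (fun s : ℝ≥0 => Real.sin (y * s)) ν :=
    Continuous.integrable_of_norm_le (by fun_prop) (fun s => Real.abs_sin_le_one _) _
  have h1 : ∀ p : ℝ≥0 × ℝ≥0, Real.cos (y * ((p.1 : ℝ) - p.2)) =
      Real.cos (y * p.1) * Real.cos (y * p.2) + Real.sin (y * p.1) * Real.sin (y * p.2) := fun p => by
    rw [mul_sub, Real.cos_sub]
  simp only [h1]
  rw [integral_add (hc.mul_prod hc) (hs.mul_prod hs), integral_prod_mul (μ := ν) (ν := ν)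
    (fun s : ℝ≥0 => Real.cos (y * s)) (fun s : ℝ≥0 => Real.cos (y * s)),
    integral_prod_mul (μ := ν) (ν := ν)
    (fun s : ℝ≥0 => Real.sin (y * s)) (fun s : ℝ≥0 => Real.sin (y * s)), Complex.sq_norm,
    Complex.normSq_apply, hre, him]
  ring

/-- The truncated square of the difference. -/
noncomputable def truncatedSqDiff (K : ℕ) (p : ℝ≥0 × ℝ≥0) : ℝ :=
  if |(p.1 : ℝ) - p.2| ≤ K then ((p.1 : ℝ) - p.2) ^ 2 else 0

theorem truncatedSqDiff_nonneg (K : ℕ) (p : ℝ≥0 × ℝ≥0) : 0 ≤ truncatedSqDiff K p := by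
  unfold truncatedSqDiff
  split_ifs <;> positivity

theorem integrable_truncatedSqDiff (K : ℕ) : Integrable (truncatedSqDiff K) (ν.prod ν) := by
  refine Integrable.of_bound (C := (K : ℝ) ^ 2) ?_ (Eventually.of_forall fun p => ?_)
  · refine (Measurable.ite ?_ (by fun_prop) measurable_const).aestronglyMeasurable
    exact measurableSet_le (by fun_prop) measurable_const
  · rw [Real.norm_of_nonneg (truncatedSqDiff_nonneg K p)]
    unfold truncatedSqDiff
    split_ifs with h
    · rw [← sq_abs]
      gcongr
    · positivity

/-- A probability measure that is not a Dirac measure has two points at positive distance. -/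
theorem exists_integral_truncatedSqDiff_pos (hν : ¬ ∃ a : ℝ≥0, ∀ᵐ s ∂ν, s = a) :
    ∃ K : ℕ, 0 < ∫ p, truncatedSqDiff K p ∂(ν.prod ν) := by
  by_contra! hcon
  apply hν
  have h1 : ∀ K : ℕ, ∀ᵐ p ∂(ν.prod ν), truncatedSqDiff K p = 0 := by
    intro K
    have := le_antisymm (hcon K) (integral_nonneg (truncatedSqDiff_nonneg K))
    exact (integral_eq_zero_iff_of_nonneg (truncatedSqDiff_nonneg K)
      (integrable_truncatedSqDiff K)).1 this
  have h2 : ∀ᵐ p ∂(ν.prod ν), p.2 = p.1 := by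
    filter_upwards [ae_all_iff.2 h1] with p hp
    obtain ⟨K, hK⟩ := exists_nat_ge |(p.1 : ℝ) - p.2|
    have := hp K
    rw [truncatedSqDiff, if_pos hK, sq_eq_zero_iff, sub_eq_zero] at this
    exact_mod_cast this.symm
  exact (Measure.ae_ae_of_ae_prod h2).exists

/-- Away from Dirac measures, the characteristic function decays quadratically at the origin. -/
theorem exists_norm_laplace_imaginary_sq_le (hν : ¬ ∃ a : ℝ≥0, ∀ᵐ s ∂ν, s = a) :
    ∃ c τ : ℝ, 0 < c ∧ 0 < τ ∧ τ ≤ 1 ∧ ∀ y : ℝ, |y| ≤ τ →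
      ‖∫ s : ℝ≥0, Complex.exp (-(Complex.I * y * ((s : ℝ) : ℂ))) ∂ν‖ ^ 2 ≤ 1 - c * y ^ 2 := by
  obtain ⟨K, hK⟩ := exists_integral_truncatedSqDiff_pos hν
  have hπ := Real.pi_pos
  -- The bound `cos u ≤ 1 - (2 / π²) u²` holds only for `|u| ≤ π`. The cutoff `|s - s'| ≤ K`
  -- together with `|y| ≤ 1 / (K + 1)` keeps `|u| ≤ 1`; beyond the cutoff `cos u ≤ 1` is enough.
  refine ⟨2 / Real.pi ^ 2 * ∫ p, truncatedSqDiff K p ∂(ν.prod ν), 1 / ((K : ℝ) + 1),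
    by positivity, by positivity, ?_, fun y hy => ?_⟩
  · rw [div_le_one (by positivity)]
    have : (0 : ℝ) ≤ K := Nat.cast_nonneg K
    linarith
  · rw [norm_laplace_imaginary_sq]
    have hcos : Integrable (fun p : ℝ≥0 × ℝ≥0 => Real.cos (y * ((p.1 : ℝ) - p.2))) (ν.prod ν) :=
      Integrable.of_bound (by fun_prop) 1 (Eventually.of_forall fun p => Real.abs_cos_le_one _)
    have h1 : ∫ p : ℝ≥0 × ℝ≥0, Real.cos (y * ((p.1 : ℝ) - p.2)) ∂(ν.prod ν) ≤
        ∫ p : ℝ≥0 × ℝ≥0, (1 - 2 / Real.pi ^ 2 * y ^ 2 * truncatedSqDiff K p) ∂(ν.prod ν) := by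
      refine integral_mono hcos ((integrable_const _).sub
        ((integrable_truncatedSqDiff K).const_mul _)) fun p => ?_
      simp only
      unfold truncatedSqDiff
      split_ifs with h
      · have h2 : |y * ((p.1 : ℝ) - p.2)| ≤ Real.pi := by
          rw [abs_mul]
          calc |y| * |(p.1 : ℝ) - p.2| ≤ 1 / ((K : ℝ) + 1) * (K + 1) := by
                gcongr
                linarith
            _ = 1 := by field_simp
            _ ≤ Real.pi := by linarith [Real.pi_gt_three]
        have := Real.cos_le_one_sub_mul_cos_sq h2
        linarith
      · simpa using Real.cos_le_one _
    refine h1.trans (le_of_eq ?_)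
    rw [integral_sub (integrable_const _) ((integrable_truncatedSqDiff K).const_mul _),
      integral_const_mul]
    simp
    ring

/-- The powers of a characteristic function stay away from the unit circle on the scale
`1 / √n`. -/
theorem exists_le_norm_laplace_pow_sub (hν : ¬ ∃ a : ℝ≥0, ∀ᵐ s ∂ν, s = a) :
    ∃ c τ : ℝ, 0 < c ∧ 0 < τ ∧ τ ≤ 1 ∧ ∀ (n : ℕ) (y : ℝ), 1 ≤ n → |y| = τ / √n → ∀ w : ℂ, ‖w‖ = 1 →
      c ≤ ‖(∫ s : ℝ≥0, Complex.exp (-(Complex.I * y * ((s : ℝ) : ℂ))) ∂ν) ^ n - w‖ := by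
  obtain ⟨c, τ, hc, hτ0, hτ1, h⟩ := exists_norm_laplace_imaginary_sq_le hν
  -- From `|φ(y)|² ≤ 1 - c τ² / n ≤ e^{-cτ²/n}` one gets `|φ(y)|^n ≤ e^{-cτ²/2}`, independently of
  -- `n`.
  refine ⟨1 - Real.exp (-(c * τ ^ 2 / 2)), τ, ?_, hτ0, hτ1, fun n y hn hy w hw => ?_⟩
  · rw [sub_pos, Real.exp_lt_one_iff]
    have : 0 < c * τ ^ 2 := by positivity
    linarith
  · have hn1 : (1 : ℝ) ≤ n := by exact_mod_cast hn
    have hn0 : (0 : ℝ) < n := by linarith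
    set φ := ∫ s : ℝ≥0, Complex.exp (-(Complex.I * y * ((s : ℝ) : ℂ))) ∂ν
    have hyτ : |y| ≤ τ := by
      rw [hy]
      exact div_le_self hτ0.le (Real.one_le_sqrt.2 hn1)
    have h1 := h y hyτ
    have hy2 : y ^ 2 = τ ^ 2 / n := by
      rw [← sq_abs, hy, div_pow, Real.sq_sqrt hn0.le]
    rw [hy2, ← mul_div_assoc] at h1
    have h2 : (‖φ‖ ^ n) ^ 2 ≤ Real.exp (-(c * τ ^ 2 / 2)) ^ 2 := by
      calc (‖φ‖ ^ n) ^ 2 = (‖φ‖ ^ 2) ^ n := by rw [← pow_mul, ← pow_mul, mul_comm]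
        _ ≤ (Real.exp (-(c * τ ^ 2 / n))) ^ n := by
          refine pow_le_pow_left₀ (by positivity) (h1.trans ?_) n
          have := Real.add_one_le_exp (-(c * τ ^ 2 / n))
          linarith
        _ = Real.exp (-(c * τ ^ 2 / 2)) ^ 2 := by
          rw [← Real.exp_nat_mul, ← Real.exp_nat_mul]
          congr 1
          push_cast
          field_simp
    have h3 : ‖φ‖ ^ n ≤ Real.exp (-(c * τ ^ 2 / 2)) :=
      (pow_le_pow_iff_left₀ (by positivity) (Real.exp_pos _).le two_ne_zero).1 h2
    have h4 := norm_sub_norm_le w (φ ^ n)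
    rw [hw, norm_pow, norm_sub_rev] at h4
    linarith

end CharacteristicFunction

/-! ### The lower bound -/

section LowerBound

variable {X : Type*} [NormedAddCommGroup X] [NormedSpace ℂ X]

/-- `cmOp` is the Hille-Phillips operator of the representing measure. -/
theorem hasHPRep_cmOp {T : C0Semigroup X} (hT : T.IsBounded) {g : ℝ → ℝ} {ν : Measure ℝ≥0}
    [IsFiniteMeasure ν] (hν : IsLaplaceTransformOf g ν) :
    HasHPRep T (fun z => ∫ s : ℝ≥0, Complex.exp (-(z * ((s : ℝ) : ℂ))) ∂ν) (cmOp T g) := by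
  obtain ⟨S, -, hS⟩ := HasHPRep.exists_of_density (T := T) hT ν (w := fun _ => 1)
    (integrable_const _) (φ := id) measurable_id
  simp only [one_smul, id] at hS
  have hex : ∃ S : X →L[ℂ] X, ∃ ν : Measure ℝ≥0, IsFiniteMeasure ν ∧ IsLaplaceTransformOf g ν ∧
      ∀ x : X, S x = ∫ s : ℝ≥0, T.op s x ∂ν := ⟨S, ν, inferInstance, hν, hS⟩
  rw [cmOp, dif_pos hex]
  obtain ⟨ν', hν'f, hν', hS'⟩ := hex.choose_spec
  have heq : ν' = ν := ext_of_laplace fun t ht => by rw [← hν' t ht, ← hν t ht]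
  subst heq
  exact ⟨Unit, inferInstance, fun _ => 1, fun _ => ν', fun _ => inferInstance,
    fun z _ => by simp, fun x => by rw [hS']; simp⟩

variable [CompleteSpace X]

/-- Telescoping: `f^{n+1} - g^{n+1} = f^n (f - g) + (f^n - g^n) g`. -/
theorem exists_hasHPRep_pow_sub_pow_div {T : C0Semigroup X} (hT : T.IsBounded) {f g h : ℂ → ℂ}
    {F G D : X →L[ℂ] X} (hF : HasHPRep T f F) (hG : HasHPRep T g G)
    (hD : HasHPRep T (fun z => (f z - g z) / h z) D) (n : ℕ) :
    ∃ S : X →L[ℂ] X, HasHPRep T (fun z => (f z ^ n - g z ^ n) / h z) S := by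
  induction n with
  | zero => exact ⟨_, ((HasHPRep.one (T := T)).smul 0).congr fun z _ => by simp⟩
  | succ n ih =>
    obtain ⟨S, hS⟩ := ih
    exact ⟨_, (((hF.pow hT n).mul hT hD).add (hS.mul hT hG)).congr fun z _ => by ring⟩

theorem norm_imaginary_cpow_neg {s : ℝ} (α : ℝ) :
    ‖(Complex.I * s) ^ (-(α : ℂ))‖ = |s| ^ (-α) := by
  rw [← Complex.ofReal_neg, Complex.norm_cpow_real, norm_mul, Complex.norm_I, one_mul,
    Complex.norm_real, Real.norm_eq_abs]

/-- The two sides differ by the factor `τ ^ (-α) ≥ 1`; this is where `τ ≤ 1` makes the final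
constant independent of `α`. -/
theorem rpow_le_scaled_rpow_neg {t τ α : ℝ} {n : ℕ} (ht : 0 < t) (hn : 1 ≤ n) (hτ0 : 0 < τ)
    (hτ1 : τ ≤ 1) (hα : 0 < α) : (t ^ 2 / n) ^ (α / 2) ≤ (τ * √n / t) ^ (-α) := by
  have hn0 : (0 : ℝ) < n := by exact_mod_cast hn
  have hs : 0 < √(n : ℝ) := Real.sqrt_pos.2 hn0
  have h1 : t ^ 2 / n = (t / √n) ^ 2 := by rw [div_pow, Real.sq_sqrt hn0.le]
  rw [h1, ← Real.rpow_natCast, ← Real.rpow_mul (by positivity), Real.rpow_neg (by positivity),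
    ← Real.inv_rpow (by positivity)]
  have h2 : ((2 : ℕ) : ℝ) * (α / 2) = α := by push_cast; ring
  rw [h2]
  refine Real.rpow_le_rpow (by positivity) ?_ hα.le
  rw [inv_div]
  gcongr
  exact mul_le_of_le_one_left hs.le hτ1

end LowerBound

theorem mainTheorem9 {X : Type*} [NormedAddCommGroup X] [NormedSpace ℂ X] [CompleteSpace X]
    (A : X →ₗ.[ℂ] X) (T : C0Semigroup X) (hT : T.IsBounded) (hA : T.generator = -A)
    (hran : Dense (Set.range fun x : A.domain => A x))
    (hspec : {r : ℝ | ∃ s : ℝ, Complex.I * (s : ℂ) ∈ UnboundedOp.spectrum A ∧ |s| = r} =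
      Set.Ici 0)
    (g : ℝ → ℝ) (hg : g ∈ ClassB2) (hne : ∃ z : ℝ, 0 < z ∧ g z ≠ Real.exp (-z)) :
    ∃ c : ℝ, 0 < c ∧ ∀ (α : ℝ), 0 < α → α ≤ 2 → ∀ (t : ℝ≥0), 0 < t → ∀ (n : ℕ), 1 ≤ n →
      ∃ S : X →L[ℂ] X,
        CompEqBounded (negFractionalPower T α)
          (cmOp (T.rescale (t / (n : ℝ≥0))) g ^ n - T.op t) S ∧
        c * ((t : ℝ) ^ 2 / (n : ℝ)) ^ (α / 2) ≤ ‖S‖ := by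
  obtain ⟨⟨⟨hcm, -⟩, h0, h1⟩, L, hL⟩ := hg
  obtain ⟨ν, hνf, hν⟩ := hcm.exists_isLaplaceTransformOf h0
  have hprob := hν.isProbabilityMeasure h0
  have hsq := hν.integrable_sq hL
  have hint := integrable_of_integrable_sq hsq
  have hmean := hν.integral_eq_one h1 hint
  have hdirac : ¬ ∃ a : ℝ≥0, ∀ᵐ s ∂ν, s = a := by
    rintro ⟨a, ha⟩
    have hconst : ∀ F : ℝ≥0 → ℝ, ∫ s, F s ∂ν = F a := fun F => by
      have : ∫ s, F s ∂ν = ∫ _, F a ∂ν := integral_congr_ae (by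
        filter_upwards [ha] with s hs
        rw [hs])
      simpa using this
    rw [hconst] at hmean
    obtain ⟨z, hz, hgz⟩ := hne
    apply hgz
    rw [hν z hz, hconst, hmean, mul_one]
  obtain ⟨c, τ, hc, hτ0, hτ1, hlow⟩ := exists_le_norm_laplace_pow_sub hdirac
  refine ⟨c, hc, fun α hα0 hα2 t ht n hn => ?_⟩
  have hn0 : (0 : ℝ) < n := by exact_mod_cast hn
  have ht0 : (0 : ℝ) < t := by exact_mod_cast ht
  set r : ℝ≥0 := t / (n : ℝ≥0) with hr
  have hr0 : 0 < r := div_pos ht (by exact_mod_cast hn)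
  have hr0' : (0 : ℝ) < r := by exact_mod_cast hr0
  have hrt : (r : ℝ) * n = t := by
    rw [hr, NNReal.coe_div, NNReal.coe_natCast]
    field_simp
  have hG := (hasHPRep_cmOp (hT.rescale r) hν).of_rescale hr0
  have hE := HasHPRep.op (T := T) r
  obtain ⟨D, hD⟩ := exists_hasHPRep_remainder (hT.rescale r) ν hint hmean hsq
  -- Rescaling produces the denominator `(r z)²`; the factor `r²` restores `z²`.
  have hD' := (hD.of_rescale hr0).smul (((r : ℝ) : ℂ) ^ 2)
  have hrC : ((r : ℝ) : ℂ) ≠ 0 := by exact_mod_cast hr0'.ne'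
  have hEpow : ∀ z : ℂ, Complex.exp (-(z * ((r : ℝ) : ℂ))) ^ n =
      Complex.exp (-(z * ((t : ℝ) : ℂ))) := fun z => by
    rw [← Complex.exp_nat_mul, ← hrt]
    congr 1
    push_cast
    ring
  obtain ⟨Q, hQ⟩ := exists_hasHPRep_pow_sub_pow_div (h := fun z => z ^ 2) hT hG hE
    (hD'.congr fun z hz => by
      have hz0 := ne_zero_of_re_pos hz
      rw [mul_comm z ((r : ℝ) : ℂ)]
      field_simp) n
  simp only [hEpow] at hQ
  have hΔ := (hG.pow hT n).sub (HasHPRep.op (T := T) t)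
  obtain ⟨a, b, P, B, ha, hb, hab⟩ := exists_hasHPRep_cpow_neg_sq hT hα0 hα2
  -- With `Δ` the difference of symbols, `z ^ (-α) Δ = a Δ + b (Δ / z²)`, and both terms lie in the
  -- algebra.
  have hS := ((ha.mul hT hΔ).add (hb.mul hT hQ)).congr
    (f' := fun z : ℂ => z ^ (-(α : ℂ)) *
      ((∫ s : ℝ≥0, Complex.exp (-(((r : ℝ) : ℂ) * z * ((s : ℝ) : ℂ))) ∂ν) ^ n -
        Complex.exp (-(z * ((t : ℝ) : ℂ))))) fun z hz => by
      rw [hab z hz]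
      ring
  refine ⟨_, compEqBounded_extHPOp hT (exists_isRegularizer_cpow_neg hT hA hran hα0 hα2) hΔ hS, ?_⟩
  -- This frequency satisfies `r σ = τ / √n` for `r = t / n`. The sign of the spectral point is
  -- unknown, but every estimate depends on `|s|` only.
  set σ : ℝ := τ * √n / t with hσ
  have hσ0 : 0 < σ := by positivity
  obtain ⟨s, hs, hsσ⟩ : ∃ s : ℝ, Complex.I * (s : ℂ) ∈ UnboundedOp.spectrum A ∧ |s| = σ := by
    have : σ ∈ {r : ℝ | ∃ s : ℝ, Complex.I * (s : ℂ) ∈ UnboundedOp.spectrum A ∧ |s| = r} := by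
      rw [hspec]
      exact hσ0.le
    exact this
  -- Away from `0` the imaginary axis avoids the branch cut, so `z ^ (-α)` is continuous at `is`.
  have hs0 : s ≠ 0 := by
    rintro rfl
    rw [abs_zero] at hsσ
    exact hσ0.ne hsσ
  have hlim : Tendsto (fun δ : ℝ => (Complex.I * s + δ) ^ (-(α : ℂ)) *
      ((∫ u : ℝ≥0, Complex.exp (-(((r : ℝ) : ℂ) * (Complex.I * s + δ) * ((u : ℝ) : ℂ))) ∂ν) ^ n -
        Complex.exp (-((Complex.I * s + δ) * ((t : ℝ) : ℂ))))) (𝓝[>] 0)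
      (𝓝 ((Complex.I * s) ^ (-(α : ℂ)) *
        ((∫ u : ℝ≥0, Complex.exp (-(Complex.I * ((r * s : ℝ) : ℂ) * ((u : ℝ) : ℂ))) ∂ν) ^ n -
        Complex.exp (-(Complex.I * s * ((t : ℝ) : ℂ)))))) := by
    have htend := (tendsto_imaginary_add s).mono_right nhdsWithin_le_nhds
    refine Tendsto.mul ?_ (Tendsto.sub (Tendsto.pow ?_ n) ?_)
    · have hslit : Complex.I * (s : ℂ) ∈ Complex.slitPlane := by
        rw [Complex.mem_slitPlane_iff]
        right
        simpa using hs0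
      exact (continuousAt_cpow_const hslit).tendsto.comp htend
    · have h3 := (continuousOn_laplace ν (Complex.I * ((r * s : ℝ) : ℂ)) (by simp)).tendsto
      refine h3.comp (tendsto_nhdsWithin_iff.2 ⟨?_, ?_⟩)
      · have h4 := htend.const_mul ((r : ℝ) : ℂ)
        convert h4 using 2
        push_cast
        ring
      · filter_upwards [self_mem_nhdsWithin] with δ hδ
        have hδ' : 0 < δ := hδ
        simp only [Complex.re_ofReal_mul]
        refine mul_nonneg hr0'.le ?_
        simpa using hδ'.le
    · have h3 : Continuous fun z : ℂ => Complex.exp (-(z * ((t : ℝ) : ℂ))) := by fun_prop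
      exact (h3.tendsto _).comp htend
  refine le_trans ?_ (hS.norm_le_of_mem_spectrum hT hA hs hlim)
  have hrs : |(r : ℝ) * s| = τ / √n := by
    rw [abs_mul, abs_of_pos hr0', hsσ, hσ, ← hrt]
    have h5 : √(n : ℝ) * √n = n := Real.mul_self_sqrt hn0.le
    have h6 : 0 < √(n : ℝ) := Real.sqrt_pos.2 hn0
    rw [mul_div_assoc', div_eq_div_iff (by positivity) h6.ne']
    linear_combination (r : ℝ) * τ * h5
  have hw : ‖Complex.exp (-(Complex.I * s * ((t : ℝ) : ℂ)))‖ = 1 := by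
    rw [Complex.norm_exp]
    simp
  have h7 := hlow n ((r : ℝ) * s) hn hrs _ hw
  rw [norm_mul, norm_imaginary_cpow_neg, hsσ, mul_comm c]
  exact mul_le_mul (rpow_le_scaled_rpow_neg ht0 hn hτ0 hτ1 hα0) h7 hc.le (by positivity)
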